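/- **Theorem 3 (cell-dependent parameters).** Consider $K$ cells. Cell $i$ has a base station with $M_i\ge S_i$ antennas and $N_i=N_i(\mathrm{SNR})$ users with $L_i\ge 1$ antennas each, of which $S_i\ge 1$ are selected to transmit one stream each. All entries of the channel matrices $H_k^{[i,j]}\in\mathbb C^{M_k\times L_i}$ (from user $j$ of cell $i$ to base station $k$) are i.i.d. zero-mean complex Gaussian with a fixed nonzero variance. They are independent of the matrices $U_k\in\mathbb C^{M_k\times S_k}$, which have orthonormal columns spanning the orthogonal complement of the interference space of base station $k$, and may have any joint law (e.g. isotropic, or constant). Put $S'_i=\sum_{k\ne i}S_k$. User $j$ of cell $i$ forms $G^{[i,j]}\in\mathbb C^{S'_i\times L_i}$ by stacking the blocks $U_k^{H}H_k^{[i,j]}$, $k\neq i$, and computes a weight vector $w=w^{[i,j]}$ from $G^{[i,j]}$. In antenna selection-based OIA, $w$ is a standard basis vector $e_l$ with the smallest $\|G^{[i,j]}e_l\|^2$. In SVD-based OIA, $w$ is a unit vector minimizing $\|G^{[i,j]}w\|^2$, i.e. a right singular vector for the smallest singular value. User $j$ reports the metric $\eta^{[i,j]}=\sum_{k\ne i}\|U_k^{H}H_k^{[i,j]}w^{[i,j]}\|^2$,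 and base station $i$ selects $S_i$ users with the smallest metrics among its $N_i$ users. (Ties are broken by an arbitrary measurable rule.) Number the selected users of cell $i$ by $1,\dots,S_i$. With the zero-forcing equalizer $F_i=[f_{i,1},\dots,f_{i,S_i}]=\big([U_i^{H}H_i^{[i,1]}w^{[i,1]},\dots,U_i^{H}H_i^{[i,S_i]}w^{[i,S_i]}]^{-1}\big)^{H}$, selected user $j$ of cell $i$ has rate $$R^{[i,j]}=\log\Big(1+\frac{\mathrm{SNR}}{\|f_{i,j}\|^2+\sum_{k\ne i}\sum_{m=1}^{S_k}|f_{i,j}^{H}U_i^{H}H_i^{[k,m]}w^{[k,m]}|^2\,\mathrm{SNR}}\Big).$$ A scheme achieves $d$ degrees of freedom (DoF) with high probability if, for every $\delta>0$, $$\lim_{\mathrm{SNR}\to\infty}\Pr\Big\{\frac{\sum_{i=1}^{K}\sum_{j=1}^{S_i}R^{[i,j]}}{\log \mathrm{SNR}}\ge d-\delta\Big\}=1 .$$ Write $f=\omega(g)$ if $\lim_{x\to\infty}g(x)/f(x)=0$. 1. Antenna selection-based OIA achieves $\sum_{i=1}^K S_i$ DoF with high probability if $N_i=\omega(\mathrm{SNR}^{S'_iK})$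 for every $i$; in fact $N_i=\omega(\mathrm{SNR}^{S'_i})$ for every $i$ already suffices. 2. If $L_i<S'_i+1$ for every $i$, SVD-based OIA achieves $\sum_{i=1}^K S_i$ DoF with high probability if $N_i=\omega(\mathrm{SNR}^{S'_iK-L_i+1})$ for every $i$; in fact $N_i=\omega(\mathrm{SNR}^{S'_i-L_i+1})$ for every $i$ already suffices. -/

import Mathlib

open MeasureTheory ProbabilityTheory Filter Topology Matrix
open scoped NNReal ENNReal

/-- Matrices carry the product (Borel) sigma-algebra of their entries. -/
noncomputable instance OIA.matrixMeasurableSpace {m n : Type*} : MeasurableSpace (Matrix m n ℂ) :=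
  inferInstanceAs (MeasurableSpace (m → n → ℂ))

namespace OIA

noncomputable section

/-- The law of a circularly symmetric zero-mean complex Gaussian variable: the real and the
imaginary part are independent real Gaussians of mean `0` and variance `v`. -/
def complexGaussian (v : ℝ≥0) : Measure ℂ :=
  ((gaussianReal 0 v).prod (gaussianReal 0 v)).map Complex.measurableEquivRealProd.symm

/-- The squared Euclidean norm of a complex vector. -/
def normSq {ι : Type*} [Fintype ι] (x : ι → ℂ) : ℝ := ∑ a, ‖x a‖ ^ 2

/-- A realization of all uplink channels: `H i j k` is the `M k × L i` channel matrix from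
user `j` of cell `i` to base station `k`. The users of a cell are numbered `0, 1, 2, …`; when
the cell has `n` users, these are the users `0, …, n - 1`. -/
abbrev Channel (K : ℕ) (L M : Fin K → ℕ) : Type :=
  (i : Fin K) → ℕ → (k : Fin K) → Matrix (Fin (M k)) (Fin (L i)) ℂ

/-- The matrices broadcast by the base stations: `U k` has size `M k × S k`. Its columns are an
orthonormal basis of the orthogonal complement of the interference space of base station `k`. -/
abbrev SignalBasis (K : ℕ) (M S : Fin K → ℕ) : Type :=
  (k : Fin K) → Matrix (Fin (M k)) (Fin (S k)) ℂ

/-- Number of streams in the cells other than `i`: the sum of `S k` over `k ≠ i`. -/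
def otherStreams {K : ℕ} (S : Fin K → ℕ) (i : Fin K) : ℕ := ∑ k ∈ Finset.univ.erase i, S k

/-- Row index of the stacked cross-link matrix of a user in cell `i`: a base station `k ≠ i`
together with one of its `S k` received dimensions. -/
abbrev CrossRow {K : ℕ} (S : Fin K → ℕ) (i : Fin K) : Type :=
  Σ k : {k : Fin K // k ≠ i}, Fin (S k)

variable {K : ℕ} {L M S : Fin K → ℕ}

/-- The channel model. All entries of all channel matrices are independent, identically
distributed zero-mean complex Gaussians with nonzero variance, and they are independent of the
matrices `U k`, which are random (with any joint law, for instance isotropic, or constant) and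
have orthonormal columns. -/
structure IsChannelModel {Ω : Type*} [MeasurableSpace Ω] (P : Measure Ω) (v : ℝ≥0)
    (H : Ω → Channel K L M) (U : Ω → SignalBasis K M S) : Prop where
  variance_ne_zero : v ≠ 0
  law : ∀ i j k a l, HasLaw (fun ω => H ω i j k a l) (complexGaussian v) P
  indep : iIndepFun
    (fun (x : Σ i : Fin K, ℕ × Σ k : Fin K, Fin (M k) × Fin (L i)) (ω : Ω) =>
      H ω x.1 x.2.1 x.2.2.1 x.2.2.2.1 x.2.2.2.2) P
  measurable_basis : Measurable U
  indep_basis : IndepFun H U P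
  orthonormal : ∀ᵐ ω ∂P, ∀ k, (U ω k)ᴴ * U ω k = 1

/-- The received direction `U kᴴ H w`, at base station `k`, of user `j` of cell `i` with weight
vector `w`, after projection off the interference space of base station `k`. -/
def received (H : Channel K L M) (U : SignalBasis K M S) (i : Fin K) (j : ℕ) (k : Fin K)
    (w : Fin (L i) → ℂ) : Fin (S k) → ℂ :=
  (U k)ᴴ *ᵥ (H i j k *ᵥ w)

/-- The stacked cross-link channel matrix `G` of user `j` of cell `i`: the blocks `U kᴴ H` over
all base stations `k ≠ i`, on top of each other. -/
def crossMatrix (H : Channel K L M) (U : SignalBasis K M S) (i : Fin K) (j : ℕ) :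
    Matrix (CrossRow S i) (Fin (L i)) ℂ :=
  Matrix.of fun r l => ((U r.1)ᴴ * H i j r.1) r.2 l

/-- A weight design: each user of cell `i` computes its weight vector from its stacked
cross-link matrix. -/
abbrev WeightRule (K : ℕ) (L S : Fin K → ℕ) : Type :=
  (i : Fin K) → Matrix (CrossRow S i) (Fin (L i)) ℂ → (Fin (L i) → ℂ)

/-- Antenna selection: the weight vector is the standard basis vector `e_l` with the least
leakage `‖G e_l‖²` (ties are broken in an arbitrary measurable way). -/
structure IsAntennaSelection (W : WeightRule K L S) : Prop where
  measurable : ∀ i, Measurable (W i)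
  argmin : ∀ i G, ∃ l : Fin (L i), W i G = Pi.single l 1 ∧
    ∀ l' : Fin (L i), normSq (G *ᵥ Pi.single l 1) ≤ normSq (G *ᵥ Pi.single l' 1)

/-- SVD-based design: the weight vector is a unit vector that minimizes `‖G w‖²` over all unit
vectors, that is, a right singular vector of `G` for its smallest singular value (chosen, among
these, in an arbitrary measurable way). -/
structure IsSVDBased (W : WeightRule K L S) : Prop where
  measurable : ∀ i, Measurable (W i)
  unit : ∀ i G, normSq (W i G) = 1
  argmin : ∀ i G (x : Fin (L i) → ℂ), normSq x = 1 → normSq (G *ᵥ W i G) ≤ normSq (G *ᵥ x)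

/-- A user selection: out of the metrics reported by the `n` users of cell `i`, base station `i`
computes the indices of its `S i` selected users. -/
abbrev SelectionRule (K : ℕ) (S : Fin K → ℕ) : Type :=
  (i : Fin K) → (n : ℕ) → (Fin n → ℝ) → Fin (S i) → ℕ

/-- Whenever there are at least `S i` users, `S i` distinct users with the smallest metrics are
selected (ties are broken in an arbitrary measurable way). -/
structure IsSmallestSelection (sel : SelectionRule K S) : Prop where
  measurable : ∀ i n, Measurable (sel i n)
  smallest : ∀ i n, S i ≤ n → ∀ η : Fin n → ℝ, ∃ e : Fin (S i) ↪ Fin n,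
    (∀ a, sel i n η a = e a) ∧ ∀ a, ∀ j, j ∉ Set.range e → η (e a) ≤ η j

/-- The weight vector of user `j` of cell `i`. -/
def weight (W : WeightRule K L S) (H : Channel K L M) (U : SignalBasis K M S)
    (i : Fin K) (j : ℕ) : Fin (L i) → ℂ :=
  W i (crossMatrix H U i j)

/-- The scheduling metric of user `j` of cell `i`: its total leakage of interference to the
other base stations. -/
def metric (W : WeightRule K L S) (H : Channel K L M) (U : SignalBasis K M S)
    (i : Fin K) (j : ℕ) : ℝ :=
  ∑ k ∈ Finset.univ.erase i, normSq (received H U i j k (weight W H U i j))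

/-- The `a`-th selected user of cell `i` when the cells have `n` users. -/
def selected (W : WeightRule K L S) (sel : SelectionRule K S) (n : Fin K → ℕ)
    (H : Channel K L M) (U : SignalBasis K M S) (i : Fin K) (a : Fin (S i)) : ℕ :=
  sel i (n i) (fun j => metric W H U i j) a

/-- The received direction at base station `k` of the `a`-th selected user of cell `i`. -/
def selectedReceived (W : WeightRule K L S) (sel : SelectionRule K S) (n : Fin K → ℕ)
    (H : Channel K L M) (U : SignalBasis K M S) (k i : Fin K) (a : Fin (S i)) : Fin (S k) → ℂ :=
  received H U i (selected W sel n H U i a) k (weight W H U i (selected W sel n H U i a))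

/-- The zero-forcing equalizer `F i = (A⁻¹)ᴴ` of base station `i`, where the columns of `A` are
the received directions of its own selected users. (If `A` is singular, this is `0`, and the
rates below are `0`.) -/
def equalizer (W : WeightRule K L S) (sel : SelectionRule K S) (n : Fin K → ℕ)
    (H : Channel K L M) (U : SignalBasis K M S) (i : Fin K) : Matrix (Fin (S i)) (Fin (S i)) ℂ :=
  ((Matrix.of fun r a => selectedReceived W sel n H U i i a r)⁻¹)ᴴ

/-- The `a`-th column of the equalizer. -/
def equalizerCol (W : WeightRule K L S) (sel : SelectionRule K S) (n : Fin K → ℕ)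
    (H : Channel K L M) (U : SignalBasis K M S) (i : Fin K) (a : Fin (S i)) : Fin (S i) → ℂ :=
  fun r => equalizer W sel n H U i r a

/-- The sum-interference on stream `a` of cell `i` after equalization. -/
def interference (W : WeightRule K L S) (sel : SelectionRule K S) (n : Fin K → ℕ) (snr : ℝ)
    (H : Channel K L M) (U : SignalBasis K M S) (i : Fin K) (a : Fin (S i)) : ℝ :=
  ∑ k ∈ Finset.univ.erase i, ∑ b : Fin (S k),
    ‖star (equalizerCol W sel n H U i a) ⬝ᵥ selectedReceived W sel n H U i k b‖ ^ 2 * snr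

/-- The achievable rate `log (1 + SINR)` of stream `a` of cell `i`. -/
def rate (W : WeightRule K L S) (sel : SelectionRule K S) (n : Fin K → ℕ) (snr : ℝ)
    (H : Channel K L M) (U : SignalBasis K M S) (i : Fin K) (a : Fin (S i)) : ℝ :=
  Real.log (1 + snr /
    (normSq (equalizerCol W sel n H U i a) + interference W sel n snr H U i a))

/-- The sum-rate of all selected users. -/
def sumRate (W : WeightRule K L S) (sel : SelectionRule K S) (n : Fin K → ℕ) (snr : ℝ)
    (H : Channel K L M) (U : SignalBasis K M S) : ℝ :=
  ∑ i, ∑ a : Fin (S i), rate W sel n snr H U i a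

/-- The scheme, with `N i snr` users in cell `i`, achieves (at least) `d` degrees of freedom
with high probability: for every `δ > 0`, the probability that the sum-rate divided by `log snr`
is at least `d - δ` tends to `1` as the signal-to-noise ratio tends to infinity. -/
def AchievesDoF {Ω : Type*} [MeasurableSpace Ω] (P : Measure Ω)
    (H : Ω → Channel K L M) (U : Ω → SignalBasis K M S) (N : Fin K → ℝ → ℕ)
    (W : WeightRule K L S) (sel : SelectionRule K S) (d : ℝ) : Prop :=
  ∀ δ : ℝ, 0 < δ → Tendsto
    (fun snr : ℝ =>
      P {ω | d - δ ≤ sumRate W sel (fun i => N i snr) snr (H ω) (U ω) / Real.log snr})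
    atTop (𝓝 1)

/-- The user scaling condition `N i = ω(snr ^ e i)` in every cell `i`. -/
def UserScaling (N : Fin K → ℝ → ℕ) (e : Fin K → ℝ) : Prop :=
  ∀ i, (fun snr : ℝ => snr ^ e i) =o[atTop] (fun snr : ℝ => (N i snr : ℝ))

end

end OIA

/-! If every selected user has metric at most `1 / snr`, then Cauchy-Schwarz bounds the interference
on a stream by a constant multiple of the squared norm of its equalizer column: the factor `snr` in
the interference cancels the `1 / snr` in the leakage. If these columns are also bounded, every rate
is `log snr - O(1)`, so the sum-rate over `log snr` exceeds `∑ S i - δ` for large `snr`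
(`sumRate_ge`). It remains to show that both conditions hold with high probability.

Leakage. Matrices with orthonormal rows preserve i.i.d. complex Gaussian vectors
(`map_mulVec_pi_complexGaussian`), so the stacked cross-link matrix has i.i.d. Gaussian entries for
any fixed basis. Its leakage is at most `x` with probability at least `c * x ^ m`. For antenna
selection `m = S'`: all `S'` entries of one column must lie in discs of area of order `x`. For the
SVD design `m = S' - (L - 1)`: a weight vector can cancel `L - 1` rows exactly, and only the other
rows cost a small disc each (`measure_exists_unit_normSq_le_ge`). With `x = 1 / snr` and `ω(snr ^
m)` users of independent metrics, the users split into `S i` blocks, each of which contains a user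
below `x` except with vanishing probability (`IsSmallestSelection.measure_exists_gt_le`).

Equalizer. Weights and selection depend only on the channels to other cells, which are independent
of the direct channels. Hence the matrix inverted by the equalizer has i.i.d. Gaussian entries
(`IsIIDChannel.measure_selectedReceived_mem_le`), a law free of `snr`; it is almost surely
invertible, so the norms of its equalizer columns are tight
(`exists_measure_not_hasBoundedEqualizer_le`).

Random bases are handled by conditioning on them. A union bound over the `2 * K` bad events
concludes (`achievesDoF_of_leakageBound`). As each cell is treated separately, the factor `K` in the
exponents is not needed; the larger exponents follow by monotonicity. -/

namespace OIA

/-! ### Complex Gaussian laws: small discs and unitary invariance. -/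

section ComplexGaussian

instance (v : ℝ≥0) : IsProbabilityMeasure (complexGaussian v) :=
  Measure.isProbabilityMeasure_map Complex.measurableEquivRealProd.symm.measurable.aemeasurable

lemma complexGaussian_apply (v : ℝ≥0) (s : Set ℂ) :
    complexGaussian v s = (gaussianReal 0 v).prod (gaussianReal 0 v)
      (Complex.measurableEquivRealProd.symm ⁻¹' s) :=
  MeasurableEquiv.map_apply _ _

lemma nullSingletonClass_complexGaussian {v : ℝ≥0} (hv : v ≠ 0) :
    NullSingletonClass (complexGaussian v) := by
  have := nullSingletonClass_gaussianReal (μ := 0) hv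
  refine ⟨fun z => ?_⟩
  rw [complexGaussian_apply]
  refine measure_mono_null (t := {z.re} ×ˢ {z.im}) ?_ (by simp)
  rintro ⟨a, b⟩ h
  simp only [Set.mem_preimage, Set.mem_singleton_iff] at h
  subst h
  simp

/-- The density is continuous and positive, hence bounded below on a compact interval that contains
all the small intervals in question. -/
lemma gaussianReal_Icc_ge {v : ℝ≥0} (hv : v ≠ 0) (R : ℝ) : ∃ c : ℝ, 0 < c ∧
    ∀ x s : ℝ, |x| ≤ R → 0 < s → s ≤ 1 →
      ENNReal.ofReal (c * s) ≤ gaussianReal 0 v (Set.Icc (x - s) (x + s)) := by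
  obtain ⟨y, -, hy⟩ := (isCompact_Icc (a := -(R + 1)) (b := |R| + 1)).exists_isMinOn
    ⟨|R| + 1, Set.right_mem_Icc.2 (by cases abs_cases R <;> linarith)⟩
    (f := gaussianPDFReal 0 v) (by unfold gaussianPDFReal; fun_prop)
  refine ⟨2 * gaussianPDFReal 0 v y, by have := gaussianPDFReal_pos 0 v y hv; positivity, ?_⟩
  intro x s hx hs hs1
  rw [gaussianReal_apply 0 hv]
  calc ENNReal.ofReal (2 * gaussianPDFReal 0 v y * s)
      = ∫⁻ _ in Set.Icc (x - s) (x + s), ENNReal.ofReal (gaussianPDFReal 0 v y) := by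
        rw [setLIntegral_const, Real.volume_Icc,
          ← ENNReal.ofReal_mul (gaussianPDFReal_nonneg _ _ _)]
        congr 1; ring
    _ ≤ _ := by
        refine setLIntegral_mono (by fun_prop) fun z hz => ENNReal.ofReal_le_ofReal (hy ?_)
        rw [abs_le] at hx
        constructor <;> cases abs_cases R <;> linarith [hz.1, hz.2]

/-- Small discs whose centres stay bounded have probability at least proportional to their area. -/
lemma complexGaussian_closedBall_ge {v : ℝ≥0} (hv : v ≠ 0) (R : ℝ) : ∃ c : ℝ, 0 < c ∧
    ∀ (z : ℂ) (s : ℝ), ‖z‖ ≤ R → 0 < s → s ≤ 1 →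
      ENNReal.ofReal (c * s ^ 2) ≤ complexGaussian v (Metric.closedBall z s) := by
  obtain ⟨c, hc, h⟩ := gaussianReal_Icc_ge hv R
  refine ⟨c ^ 2 / 4, by positivity, fun z s hz hs hs1 => ?_⟩
  rw [complexGaussian_apply]
  -- The square of half-side `s / 2` lies in the disc of radius `s`, and its measure factors.
  have key : Set.Icc (z.re - s / 2) (z.re + s / 2) ×ˢ Set.Icc (z.im - s / 2) (z.im + s / 2) ⊆
      Complex.measurableEquivRealProd.symm ⁻¹' Metric.closedBall z s := by
    rintro ⟨a, b⟩ ⟨ha, hb⟩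
    simp only [Set.mem_Icc, Set.mem_preimage, Metric.mem_closedBall, dist_eq_norm] at *
    refine (Complex.norm_le_abs_re_add_abs_im _).trans ?_
    have h1 : |a - z.re| ≤ s / 2 := abs_le.2 (by constructor <;> linarith)
    have h2 : |b - z.im| ≤ s / 2 := abs_le.2 (by constructor <;> linarith)
    simp only [Complex.sub_re, Complex.sub_im, Complex.measurableEquivRealProd_symm_apply]
    linarith
  refine le_trans ?_ (measure_mono key)
  rw [Measure.prod_prod]
  refine le_trans (le_of_eq ?_) (mul_le_mul'
    (h z.re (s / 2) ((Complex.abs_re_le_norm z).trans hz) (by positivity) (by linarith))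
    (h z.im (s / 2) ((Complex.abs_im_le_norm z).trans hz) (by positivity) (by linarith)))
  rw [← ENNReal.ofReal_mul (by positivity)]
  congr 1; ring

/-- The exponent involves `ℓ` only through the squared modulus of its complex coefficient, which is
what makes the law invariant under unitary maps. -/
lemma charFunDual_complexGaussian (v : ℝ≥0) (ℓ : StrongDual ℝ ℂ) :
    charFunDual (complexGaussian v) ℓ =
      Complex.exp (-((v : ℝ) * (ℓ 1 ^ 2 + ℓ Complex.I ^ 2) / 2 : ℝ)) := by
  have hmap : complexGaussian v = ((gaussianReal 0 v).prod (gaussianReal 0 v)).map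
      (Complex.equivRealProdCLM.symm : ℝ × ℝ →L[ℝ] ℂ) := rfl
  have h1 : ∀ ℓ' : StrongDual ℝ ℝ, charFunDual (gaussianReal 0 v) ℓ' =
      Complex.exp (-((v : ℝ) * ℓ' 1 ^ 2 / 2 : ℝ)) := by
    intro ℓ'
    rw [charFunDual_eq_charFun_map_one, gaussianReal_map_continuousLinearMap, charFun_gaussianReal]
    simp [Real.coe_toNNReal _ (sq_nonneg (ℓ' 1))]
    ring_nf
  rw [hmap, charFunDual_map, charFunDual_prod, h1, h1, ← Complex.exp_add]
  simp only [ContinuousLinearMap.comp_apply, ContinuousLinearMap.inl_apply,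
    ContinuousLinearMap.inr_apply, ContinuousLinearEquiv.coe_coe]
  have e1 : Complex.equivRealProdCLM.symm (1, 0) = 1 := by
    apply Complex.ext <;> simp
  have e2 : Complex.equivRealProdCLM.symm (0, 1) = Complex.I := by
    apply Complex.ext <;> simp
  rw [e1, e2]
  congr 1
  push_cast
  ring

/-- A matrix with orthonormal rows maps a vector of i.i.d. complex Gaussians to such a vector. -/
lemma map_mulVec_pi_complexGaussian {ι κ : Type*} [Fintype ι] [Fintype κ] [DecidableEq κ]
    (v : ℝ≥0) (B : Matrix κ ι ℂ) (hB : B * Bᴴ = 1) :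
    (Measure.pi fun _ : ι => complexGaussian v).map (fun z => B *ᵥ z) =
      Measure.pi fun _ : κ => complexGaussian v := by
  classical
  let T : (ι → ℂ) →L[ℝ] (κ → ℂ) := LinearMap.toContinuousLinearMap
    ((Matrix.mulVecLin B).restrictScalars ℝ)
  have hT : (fun z => B *ᵥ z) = T := rfl
  rw [hT]
  have : IsFiniteMeasure ((Measure.pi fun _ : ι => complexGaussian v).map T) := by
    infer_instance
  refine Measure.ext_of_charFunDual ?_
  ext ℓ
  rw [charFunDual_map, charFunDual_pi, charFunDual_pi]
  simp only [charFunDual_complexGaussian]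
  rw [← Complex.exp_sum, ← Complex.exp_sum]
  congr 1
  simp only [Finset.sum_neg_distrib, ← Complex.ofReal_sum, ← Finset.sum_div, ← Finset.mul_sum]
  congr 5
  -- the coefficient vector of `ℓ`
  let c : κ → ℂ := fun k => ℓ (Pi.single k 1) - ℓ (Pi.single k Complex.I) * Complex.I
  have hℓ : ∀ z : κ → ℂ, ℓ z = (∑ k, c k * z k).re := by
    intro z
    have hz : z = ∑ k, ((z k).re • (Pi.single k 1 : κ → ℂ) +
        (z k).im • (Pi.single k Complex.I : κ → ℂ)) := by
      funext k
      simp only [Finset.sum_apply, Pi.add_apply, Pi.smul_apply, Pi.single_apply]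
      simp [Finset.sum_add_distrib, Complex.re_add_im]
    conv_lhs => rw [hz]
    rw [map_sum, Complex.re_sum]
    refine Finset.sum_congr rfl fun k _ => ?_
    rw [map_add, map_smul, map_smul]
    simp [c]
    ring
  -- The values of `ℓ` at `z` and `I • z` are the real part and minus the imaginary part of one
  -- complex number.
  have hsq : ∀ z : κ → ℂ, ℓ z ^ 2 + ℓ (Complex.I • z) ^ 2 = ‖∑ k, c k * z k‖ ^ 2 := by
    intro z
    have : ∑ k, c k * (Complex.I • z) k = Complex.I * ∑ k, c k * z k := by
      rw [Finset.mul_sum]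
      refine Finset.sum_congr rfl fun k _ => ?_
      simp; ring
    rw [hℓ, hℓ, this, ← Complex.normSq_eq_norm_sq, Complex.normSq_apply]
    simp; ring
  have hL : ∀ i, (ℓ.comp T).comp (ContinuousLinearMap.single ℝ (fun _ => ℂ) i) 1 ^ 2 +
      (ℓ.comp T).comp (ContinuousLinearMap.single ℝ (fun _ => ℂ) i) Complex.I ^ 2 =
      ‖(c ᵥ* B) i‖ ^ 2 := by
    intro i
    have h1 : T (Pi.single i 1) = B.col i := by
      change B *ᵥ _ = _
      simp
    have h2 : T (Pi.single i Complex.I) = Complex.I • B.col i := by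
      change B *ᵥ _ = _
      rw [← h1]
      change _ = Complex.I • (B *ᵥ _)
      rw [← Matrix.mulVec_smul, ← Pi.single_smul]
      simp
    simp only [ContinuousLinearMap.comp_apply, ContinuousLinearMap.single_apply, h1, h2]
    rw [hsq]
    rfl
  have hR : ∀ k, ℓ.comp (ContinuousLinearMap.single ℝ (fun _ => ℂ) k) 1 ^ 2 +
      ℓ.comp (ContinuousLinearMap.single ℝ (fun _ => ℂ) k) Complex.I ^ 2 = ‖c k‖ ^ 2 := by
    intro k
    have h2 : (Pi.single k Complex.I : κ → ℂ) = Complex.I • Pi.single k 1 := by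
      rw [← Pi.single_smul]; simp
    simp only [ContinuousLinearMap.comp_apply, ContinuousLinearMap.single_apply, h2]
    rw [hsq]
    simp [Pi.single_apply]
  simp only [hL, hR]
  -- Orthonormality of the rows of `B` says that `c ↦ c ᵥ* B` preserves the norm, so the two
  -- exponents agree.
  have h3 : (c ᵥ* B) ⬝ᵥ star (c ᵥ* B) = c ⬝ᵥ star c := by
    rw [star_vecMul, ← Matrix.dotProduct_mulVec, Matrix.mulVec_mulVec, hB, Matrix.one_mulVec]
  have h4 := congrArg Complex.re h3
  simp only [dotProduct, Pi.star_apply, RCLike.star_def, Complex.mul_conj,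
    Complex.normSq_eq_norm_sq, ← Complex.ofReal_sum, Complex.ofReal_re] at h4
  exact h4

end ComplexGaussian

/-! ### Zero sets of polynomials and almost sure invertibility. -/

section PolynomialZeros

/-- A nonzero polynomial vanishes on a null set of a product of atomless measures. -/
lemma measure_pi_mvPolynomial_zeros {n : ℕ} (μ : Measure ℂ) [IsProbabilityMeasure μ]
    [NullSingletonClass μ] (p : MvPolynomial (Fin n) ℂ) (hp : p ≠ 0) :
    Measure.pi (fun _ : Fin n => μ) {x | MvPolynomial.eval x p = 0} = 0 := by
  induction n with
  | zero =>
    have : {x : Fin 0 → ℂ | MvPolynomial.eval x p = 0} = ∅ := by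
      ext x
      simp only [Set.mem_ofPred_eq, Set.mem_empty_iff_false, iff_false]
      rw [MvPolynomial.eq_C_of_isEmpty p] at hp ⊢
      simpa using hp
    simp [this]
  | succ n ih =>
    have hq : MvPolynomial.finSuccEquiv ℂ n p ≠ 0 := by simpa using hp
    obtain ⟨d, hd⟩ : ∃ d, (MvPolynomial.finSuccEquiv ℂ n p).coeff d ≠ 0 := by
      by_contra! h
      exact hq (Polynomial.ext (by simpa using h))
    have hmp := (measurePreserving_piFinSuccAbove (fun _ : Fin (n + 1) => μ) 0).symm
    have hms : MeasurableSet {x : Fin (n + 1) → ℂ | MvPolynomial.eval x p = 0} :=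
      (measurableSet_singleton (0 : ℂ)).preimage (MvPolynomial.continuous_eval p).measurable
    -- Off the null set where the coefficient of degree `d` vanishes, the slice is a nonzero
    -- polynomial in one variable, so it has finitely many roots.
    have key : ∀ᵐ y ∂Measure.pi (fun _ : Fin n => μ),
        μ {a | MvPolynomial.eval (Fin.cons a y : Fin (n + 1) → ℂ) p = 0} = 0 := by
      have := ih _ hd
      rw [measure_eq_zero_iff_ae_notMem] at this
      filter_upwards [this] with y hy
      have hpoly : Polynomial.map (MvPolynomial.eval y) (MvPolynomial.finSuccEquiv ℂ n p) ≠ 0 := by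
        intro h0
        apply hy
        have := congrArg (fun q => Polynomial.coeff q d) h0
        simpa [Polynomial.coeff_map] using this
      refine (Set.Finite.countable ?_).measure_zero μ
      refine (Polynomial.finite_setOfPred_isRoot hpoly).subset fun a ha => ?_
      change MvPolynomial.eval _ p = 0 at ha
      rw [MvPolynomial.eval_eq_eval_mv_eval'] at ha
      exact ha
    rw [← hmp.measure_preimage_equiv,
      Measure.prod_apply_symm (hms.preimage (MeasurableEquiv.measurable _)),
      lintegral_eq_zero_iff (measurable_measure_prodMk_right
        (hms.preimage (MeasurableEquiv.measurable _)))]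
    filter_upwards [key] with y hy
    refine measure_mono_null (fun a ha => ?_) hy
    simpa [MeasurableEquiv.piFinSuccAbove, Fin.insertNthEquiv] using ha

lemma measure_pi_mvPolynomial_zeros' {ι : Type*} [Fintype ι] (μ : Measure ℂ)
    [IsProbabilityMeasure μ] [NullSingletonClass μ] (p : MvPolynomial ι ℂ) (hp : p ≠ 0) :
    Measure.pi (fun _ : ι => μ) {x | MvPolynomial.eval x p = 0} = 0 := by
  let e := Fintype.equivFin ι
  have hp' : MvPolynomial.rename e p ≠ 0 := by
    simpa using (MvPolynomial.rename_injective e e.injective).ne hp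
  have h := measure_pi_mvPolynomial_zeros μ _ hp'
  rw [← (measurePreserving_piCongrLeft (fun _ => μ) e).measure_preimage_equiv] at h
  refine measure_mono_null (fun x hx => ?_) h
  simp only [Set.mem_preimage, Set.mem_ofPred_eq, MvPolynomial.eval_rename] at hx ⊢
  convert hx
  funext i
  simp [MeasurableEquiv.piCongrLeft]

/-- A square matrix with independent entries of an atomless law is almost surely invertible. -/
lemma ae_det_ne_zero {κ : Type*} [Fintype κ] [DecidableEq κ] (μ : Measure ℂ)
    [IsProbabilityMeasure μ] [NullSingletonClass μ] :
    ∀ᵐ x ∂Measure.pi (fun _ : κ × κ => μ), (Matrix.of fun a b => x (a, b)).det ≠ 0 := by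
  refine measure_mono_null (fun x hx => ?_)
    (measure_pi_mvPolynomial_zeros' μ _ (det_mvPolynomialX_ne_zero κ ℂ))
  simp only [Set.mem_compl_iff, Set.mem_ofPred_eq, not_not] at hx ⊢
  rw [RingHom.map_det, RingHom.mapMatrix_apply, ← hx]
  congr 1
  exact mvPolynomialX_map_eval₂ (RingHom.id ℂ) (Matrix.of fun a b => x (a, b))

end PolynomialZeros

/-! ### Conditioning on independent variables, and marginals of products. -/

section Freezing

variable {Ω α β : Type*} [MeasurableSpace Ω] [MeasurableSpace α] [MeasurableSpace β]
  {P : Measure Ω} [IsProbabilityMeasure P] {X : Ω → α} {Y : Ω → β}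

/-- Conditioning on one of two independent variables. -/
lemma measure_prodMk_mem_eq_lintegral (hX : AEMeasurable X P) (hY : AEMeasurable Y P)
    (hXY : IndepFun X Y P) {B : Set (α × β)} (hB : MeasurableSet B) :
    P {ω | (X ω, Y ω) ∈ B} = ∫⁻ x, P {ω | (x, Y ω) ∈ B} ∂(P.map X) := by
  have h1 := (indepFun_iff_map_prod_eq_prod_map_map hX hY).1 hXY
  have h2 : P {ω | (X ω, Y ω) ∈ B} = P.map (fun ω => (X ω, Y ω)) B :=
    (Measure.map_apply_of_aemeasurable (hX.prodMk hY) hB).symm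
  rw [h2, h1, Measure.prod_apply hB]
  refine lintegral_congr fun x => ?_
  rw [Measure.map_apply_of_aemeasurable hY (measurable_prodMk_left hB)]
  rfl

lemma measure_prodMk_mem_le (hX : AEMeasurable X P) (hY : AEMeasurable Y P)
    (hXY : IndepFun X Y P) {B : Set (α × β)} (hB : MeasurableSet B) {ε : ℝ≥0∞}
    (h : ∀ᵐ x ∂(P.map X), P {ω | (x, Y ω) ∈ B} ≤ ε) :
    P {ω | (X ω, Y ω) ∈ B} ≤ ε := by
  rw [measure_prodMk_mem_eq_lintegral hX hY hXY hB]
  have := Measure.isProbabilityMeasure_map hX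
  calc _ ≤ ∫⁻ _, ε ∂(P.map X) := lintegral_mono_ae h
    _ = ε := by simp

lemma le_measure_prodMk_mem (hX : AEMeasurable X P) (hY : AEMeasurable Y P)
    (hXY : IndepFun X Y P) {B : Set (α × β)} (hB : MeasurableSet B) {E : Set α}
    (hE : MeasurableSet E) {q : ℝ≥0∞} (h : ∀ x ∈ E, q ≤ P {ω | (x, Y ω) ∈ B}) :
    q * P {ω | X ω ∈ E} ≤ P {ω | (X ω, Y ω) ∈ B} := by
  rw [measure_prodMk_mem_eq_lintegral hX hY hXY hB]
  calc q * P {ω | X ω ∈ E} = ∫⁻ _ in E, q ∂(P.map X) := by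
        rw [setLIntegral_const, Measure.map_apply_of_aemeasurable hX hE]; rfl
    _ ≤ ∫⁻ x in E, P {ω | (x, Y ω) ∈ B} ∂(P.map X) := setLIntegral_mono' hE h
    _ ≤ _ := setLIntegral_le_lintegral _ _

lemma map_precomp_pi {ι κ : Type*} [Fintype ι] [Fintype κ] (μ : Measure α)
    [IsProbabilityMeasure μ] {g : κ → ι} (hg : Function.Injective g) :
    (Measure.pi fun _ : ι => μ).map (fun z k => z (g k)) = Measure.pi fun _ : κ => μ := by
  have h : iIndepFun (fun (i : ι) (z : ι → α) => z i) (Measure.pi fun _ => μ) :=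
    iIndepFun_pi (X := fun _ => id) (fun _ => aemeasurable_id)
  refine ((h.precomp hg).hasLaw_pi (μ := fun _ => μ) fun k => ?_).map_eq
  exact (measurePreserving_eval (fun _ => μ) (g k)).hasLaw

end Freezing

/-! ### Measurability of determinants and inverses. -/

section MatrixMeasurability

variable {α κ : Type*} [MeasurableSpace α] [Fintype κ] [DecidableEq κ]

lemma measurable_det {A : α → Matrix κ κ ℂ} (hA : ∀ i j, Measurable fun a => A a i j) :
    Measurable fun a => (A a).det := by
  simp only [Matrix.det_apply]
  refine Finset.measurable_sum _ fun σ _ => Measurable.const_smul ?_ _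
  exact Finset.measurable_prod _ fun i _ => hA _ _

/-- The adjugate formula holds for singular matrices too, where both sides are `0`, so no
restriction on the determinant is needed. -/
lemma measurable_inv_apply {A : α → Matrix κ κ ℂ} (hA : ∀ i j, Measurable fun a => A a i j)
    (i j : κ) : Measurable fun a => (A a)⁻¹ i j := by
  simp only [Matrix.inv_def, Matrix.smul_apply, Ring.inverse_eq_inv', smul_eq_mul,
    Matrix.adjugate_apply]
  refine (measurable_det hA).inv.mul (measurable_det fun k l => ?_)
  simp only [Matrix.updateRow_apply]
  split_ifs
  · exact measurable_const
  · exact hA _ _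

end MatrixMeasurability

/-! ### Probability that a Gaussian matrix has small leakage. -/

section UserProbability

lemma normSq_nonneg {ι : Type*} [Fintype ι] (x : ι → ℂ) : 0 ≤ normSq x :=
  Finset.sum_nonneg fun _ _ => by positivity

lemma normSq_smul {ι : Type*} [Fintype ι] (c : ℂ) (x : ι → ℂ) :
    normSq (c • x) = ‖c‖ ^ 2 * normSq x := by
  simp [normSq, Finset.mul_sum, mul_pow]

lemma normSq_single {ι : Type*} [Fintype ι] [DecidableEq ι] (l : ι) :
    normSq (Pi.single l (1 : ℂ)) = 1 := by
  simp [normSq, Pi.single_apply, apply_ite]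

@[fun_prop]
lemma measurable_normSq {ι : Type*} [Fintype ι] : Measurable (normSq : (ι → ℂ) → ℝ) := by
  unfold normSq
  fun_prop

variable {ρ : Type*} [Fintype ρ] {v : ℝ≥0}

/-- A fixed column of a complex Gaussian matrix with `m` rows has squared norm at most `x` with
probability at least of the order `x ^ m`. -/
lemma measure_column_normSq_le_ge {κ : Type*} [Fintype κ] [DecidableEq κ] (hv : v ≠ 0) (l : κ) :
    ∃ c : ℝ, 0 < c ∧ ∀ x : ℝ, 0 < x → x ≤ 1 →
      ENNReal.ofReal (c * x ^ Fintype.card ρ) ≤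
        (Measure.pi fun _ : ρ × κ => complexGaussian v)
          {z | normSq (Matrix.of (fun r l => z (r, l)) *ᵥ Pi.single l 1) ≤ x} := by
  obtain ⟨c, hc, h⟩ := complexGaussian_closedBall_ge hv 0
  set m := Fintype.card ρ
  refine ⟨(c / (m + 1)) ^ m, by positivity, fun x hx hx1 => ?_⟩
  -- Entries of modulus at most `s` in `m` rows give total at most `x`; the `+ 1` covers `m = 0`.
  set s := √(x / (m + 1)) with hs
  have hs2 : s ^ 2 = x / (m + 1) := Real.sq_sqrt (by positivity)
  have hs0 : 0 < s := Real.sqrt_pos.2 (by positivity)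
  have hs1 : s ≤ 1 := by
    refine Real.sqrt_le_one.2 ?_
    rw [div_le_one (by positivity)]
    have : (0 : ℝ) ≤ m := by positivity
    linarith
  calc ENNReal.ofReal ((c / (m + 1)) ^ m * x ^ m) = ∏ _ : ρ, ENNReal.ofReal (c * s ^ 2) := by
        rw [Finset.prod_const, ← ENNReal.ofReal_pow (by positivity), Finset.card_univ, hs2,
          ← mul_pow]
        congr 2; ring
    _ ≤ ∏ _ : ρ, complexGaussian v (Metric.closedBall 0 s) :=
        Finset.prod_le_prod' fun _ _ => h 0 s (by simp) hs0 hs1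
    _ = (Measure.pi fun _ : ρ => complexGaussian v)
          (Set.univ.pi fun _ => Metric.closedBall 0 s) := (Measure.pi_pi _ _).symm
    _ = _ := by
        rw [← map_precomp_pi (complexGaussian v) (g := fun r : ρ => (r, l))
          (fun a b hab => congrArg Prod.fst hab), Measure.map_apply (by fun_prop)
          (MeasurableSet.univ_pi fun _ => Metric.isClosed_closedBall.measurableSet)]
    _ ≤ _ := by
        refine measure_mono fun z hz => ?_
        simp only [Set.mem_preimage, Set.mem_univ_pi, Metric.mem_closedBall, dist_zero_right] at hz
        simp only [Set.mem_ofPred_eq, Matrix.mulVec_single_one, normSq, Matrix.col_apply,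
          Matrix.of_apply]
        calc ∑ r, ‖z (r, l)‖ ^ 2 ≤ ∑ _r : ρ, s ^ 2 :=
              Finset.sum_le_sum fun r _ => pow_le_pow_left₀ (norm_nonneg _) (hz r) 2
          _ = m * (x / (m + 1)) := by simp [hs2, m]
          _ ≤ x := by
              rw [mul_div_assoc', div_le_iff₀ (by positivity)]
              nlinarith

/-- Some unit vector is shrunk to squared length at most `x` by a complex Gaussian matrix with `m`
rows and `n ≤ m` columns, with probability at least of the order `x ^ (m - (n - 1))`. -/
lemma measure_exists_unit_normSq_le_ge {κ : Type*} [Fintype κ] [DecidableEq κ] (hv : v ≠ 0)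
    (l₀ : κ) (hcard : Fintype.card κ ≤ Fintype.card ρ) :
    ∃ c : ℝ, 0 < c ∧ ∀ x : ℝ, 0 < x → x ≤ 1 →
      ENNReal.ofReal (c * x ^ (Fintype.card ρ - (Fintype.card κ - 1))) ≤
        (Measure.pi fun _ : ρ × κ => complexGaussian v)
          {z | ∃ w, normSq w = 1 ∧ normSq (Matrix.of (fun r l => z (r, l)) *ᵥ w) ≤ x} := by
  classical
  set P : Measure (ρ × κ → ℂ) := Measure.pi fun _ : ρ × κ => complexGaussian v
  have hcard' : Fintype.card {l // l ≠ l₀} = Fintype.card κ - 1 := by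
    simp [Fintype.card_subtype_compl]
  -- The range of `e` consists of `card κ - 1` rows to be cancelled exactly. `S` collects the
  -- entries of column `l₀` in the other rows, the only entries forced to be small relative to the
  -- rest.
  obtain ⟨e⟩ : Nonempty ({l // l ≠ l₀} ↪ ρ) :=
    Function.Embedding.nonempty_of_card_le (by omega)
  set S : Finset (ρ × κ) := (Finset.univ.map e)ᶜ ×ˢ {l₀} with hS
  have hScard : S.card = Fintype.card ρ - (Fintype.card κ - 1) := by
    rw [hS, Finset.card_product, Finset.card_compl, Finset.card_map, Finset.card_univ, hcard']
    simp
  have hST : Disjoint Sᶜ S := disjoint_compl_left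
  have hmemS : ∀ r l, (r, l) ∈ S ↔ (∀ a, e a ≠ r) ∧ l = l₀ := by
    intro r l
    simp only [hS, Finset.mem_product, Finset.mem_compl, Finset.mem_map, Finset.mem_univ, true_and,
      Finset.mem_singleton, not_exists]
  -- The default `0` is never read: the definitions below evaluate `ext y` only outside `S`.
  let ext : ((Sᶜ : Finset (ρ × κ)) → ℂ) → ρ × κ → ℂ :=
    fun y i => if h : i ∈ Sᶜ then y ⟨i, h⟩ else 0
  have hext : ∀ i, Measurable fun y => ext y i := by
    intro i
    by_cases h : i ∈ Sᶜ
    · simp only [ext, h, dite_true]; fun_prop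
    · simp only [ext, h, dite_false]; fun_prop
  let A : ((Sᶜ : Finset (ρ × κ)) → ℂ) → Matrix {l // l ≠ l₀} {l // l ≠ l₀} ℂ :=
    fun y => Matrix.of fun a b => ext y (e a, b.1)
  have hA : ∀ a b, Measurable fun y => A y a b := fun a b => hext _
  let sol : ((Sᶜ : Finset (ρ × κ)) → ℂ) → {l // l ≠ l₀} → ℂ :=
    fun y => (A y)⁻¹ *ᵥ fun a => ext y (e a, l₀)
  have hsol : ∀ a, Measurable fun y => sol y a := fun a =>
    Finset.measurable_sum _ fun b _ => (measurable_inv_apply hA a b).mul (hext _)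
  -- The combination of the other columns that solves the system in the rows of `e`: leakage
  -- vanishes in row `r` when the entry `(r, l₀)` equals `ζ y r`.
  let ζ : ((Sᶜ : Finset (ρ × κ)) → ℂ) → ρ → ℂ := fun y r => ∑ l, ext y (r, l.1) * sol y l
  have hζ : ∀ r, Measurable fun y => ζ y r := fun r =>
    Finset.measurable_sum _ fun b _ => (hext _).mul (hsol _)
  let E : ℕ → Set ((Sᶜ : Finset (ρ × κ)) → ℂ) := fun R => {y | (A y).det ≠ 0 ∧ ∀ r, ‖ζ y r‖ ≤ R}
  have hE : ∀ R, MeasurableSet (E R) := by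
    intro R
    have : E R = {y | (A y).det = 0}ᶜ ∩ ⋂ r, {y | ‖ζ y r‖ ≤ R} := by
      ext y; simp [E]
    rw [this]
    refine ((measurableSet_singleton (0 : ℂ)).preimage (measurable_det hA)).compl.inter ?_
    exact MeasurableSet.iInter fun r => measurableSet_le (hζ r).norm measurable_const
  let Yv : (ρ × κ → ℂ) → ((Sᶜ : Finset (ρ × κ)) → ℂ) := fun z i => z i
  let Dv : (ρ × κ → ℂ) → (S → ℂ) := fun z i => z i
  have hYm : Measurable Yv := by fun_prop
  have hDm : Measurable Dv := by fun_prop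
  have hind : IndepFun Yv Dv P := by
    have h : iIndepFun (fun (i : ρ × κ) (z : ρ × κ → ℂ) => z i) P :=
      iIndepFun_pi (X := fun _ => id) (fun _ => aemeasurable_id)
    exact h.indepFun_finset _ _ hST (fun i => measurable_pi_apply i)
  have hextY : ∀ z i, i ∉ S → ext (Yv z) i = z i := by
    intro z i hi
    simp [ext, Yv, hi]
  -- with positive probability the truncated system is solvable with a bounded solution
  obtain ⟨R, hR⟩ : ∃ R, P {z | Yv z ∈ E R} ≠ 0 := by
    by_contra! h0
    have hnull : P (⋃ R, {z | Yv z ∈ E R}) = 0 := measure_iUnion_null h0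
    have := nullSingletonClass_complexGaussian hv
    have hdet := ae_det_ne_zero (κ := {l // l ≠ l₀}) (complexGaussian v)
    rw [← map_precomp_pi (complexGaussian v)
      (g := fun ab : {l // l ≠ l₀} × {l // l ≠ l₀} => (e ab.1, ab.2.1))
      (fun a b hab => by
        simp only [Prod.mk.injEq, EmbeddingLike.apply_eq_iff_eq] at hab
        exact Prod.ext hab.1 (Subtype.ext hab.2))] at hdet
    have hdet' := ae_of_ae_map (Measurable.aemeasurable (by fun_prop)) hdet
    have huniv : ∀ᵐ z ∂P, False := by
      filter_upwards [hdet', measure_eq_zero_iff_ae_notMem.1 hnull] with z hz1 hz2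
      apply hz2
      obtain ⟨R, hR⟩ := exists_nat_ge (∑ r, ‖ζ (Yv z) r‖)
      refine Set.mem_iUnion.2 ⟨R, ?_, fun r => ?_⟩
      · convert hz1 using 2
        funext a b
        exact hextY z _ (by simp [hmemS])
      · exact (Finset.single_le_sum (f := fun r => ‖ζ (Yv z) r‖) (fun _ _ => norm_nonneg _)
          (Finset.mem_univ r)).trans hR
    exact huniv.exists.elim fun _ h => h
  -- On `E R` the disc centres are bounded by `R`, so a single constant serves for all of them.
  obtain ⟨c, hc, hball⟩ := complexGaussian_closedBall_ge hv R
  set m := Fintype.card ρ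
  set q := m - (Fintype.card κ - 1)
  have hPE : 0 < (P {z | Yv z ∈ E R}).toReal := ENNReal.toReal_pos hR (measure_ne_top _ _)
  refine ⟨(c / (m + 1)) ^ q * (P {z | Yv z ∈ E R}).toReal, by positivity, fun x hx hx1 => ?_⟩
  set s := √(x / (m + 1)) with hs
  have hs2 : s ^ 2 = x / (m + 1) := Real.sq_sqrt (by positivity)
  have hs0 : 0 < s := Real.sqrt_pos.2 (by positivity)
  have hs1 : s ≤ 1 := by
    refine Real.sqrt_le_one.2 ?_
    rw [div_le_one (by positivity)]
    have : (0 : ℝ) ≤ m := by positivity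
    linarith
  let B : Set (((Sᶜ : Finset (ρ × κ)) → ℂ) × (S → ℂ)) :=
    {yd | yd.1 ∈ E R ∧ ∀ i : S, ‖yd.2 i - ζ yd.1 i.1.1‖ ≤ s}
  have hB : MeasurableSet B := by
    have : B = Prod.fst ⁻¹' E R ∩ ⋂ i : S,
        {yd : ((Sᶜ : Finset (ρ × κ)) → ℂ) × (S → ℂ) | ‖yd.2 i - ζ yd.1 i.1.1‖ ≤ s} := by
      ext y; simp only [B, Set.mem_ofPred_eq, Set.mem_inter_iff, Set.mem_preimage, Set.mem_iInter]
    rw [this]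
    refine ((hE R).preimage measurable_fst).inter ?_
    refine MeasurableSet.iInter fun i => measurableSet_le (Measurable.norm ?_) measurable_const
    exact Measurable.sub (f := fun yd : ((Sᶜ : Finset (ρ × κ)) → ℂ) × (S → ℂ) => yd.2 i)
      (by fun_prop) ((hζ i.1.1).comp measurable_fst)
  have hlow : ∀ y ∈ E R, ENNReal.ofReal ((c / (m + 1)) ^ q * x ^ q) ≤
      P {z | (y, Dv z) ∈ B} := by
    intro y hy
    calc ENNReal.ofReal ((c / (m + 1)) ^ q * x ^ q) = ∏ _ : S, ENNReal.ofReal (c * s ^ 2) := by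
          rw [Finset.prod_const, ← ENNReal.ofReal_pow (by positivity), Finset.card_univ,
            Fintype.card_coe, hScard, hs2, ← mul_pow]
          congr 2; ring
      _ ≤ ∏ i : S, complexGaussian v (Metric.closedBall (ζ y i.1.1) s) :=
          Finset.prod_le_prod' fun i _ => hball _ s (hy.2 _) hs0 hs1
      _ = (Measure.pi fun _ : S => complexGaussian v)
            (Set.univ.pi fun i => Metric.closedBall (ζ y i.1.1) s) := (Measure.pi_pi _ _).symm
      _ = _ := by
          rw [← map_precomp_pi (complexGaussian v) (g := fun i : S => i.1)
            Subtype.val_injective, Measure.map_apply (by fun_prop)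
            (MeasurableSet.univ_pi fun _ => Metric.isClosed_closedBall.measurableSet)]
      _ ≤ _ := by
          refine measure_mono fun z hz => ⟨hy, fun i => ?_⟩
          have := hz i (Set.mem_univ i)
          rwa [Metric.mem_closedBall, dist_eq_norm] at this
  have hfinal := le_measure_prodMk_mem hYm.aemeasurable hDm.aemeasurable hind hB (hE R) hlow
  calc ENNReal.ofReal ((c / (m + 1)) ^ q * (P {z | Yv z ∈ E R}).toReal * x ^ q)
      = ENNReal.ofReal ((c / (m + 1)) ^ q * x ^ q) * P {z | Yv z ∈ E R} := by
        rw [mul_right_comm, ENNReal.ofReal_mul (by positivity),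
          ENNReal.ofReal_toReal (measure_ne_top _ _)]
    _ ≤ P {z | (Yv z, Dv z) ∈ B} := hfinal
    _ ≤ _ := by
      refine measure_mono ?_
      rintro z ⟨hzE, hzB⟩
      set G : Matrix ρ κ ℂ := Matrix.of (fun r l => z (r, l)) with hG
      -- With coefficient `1` on column `l₀` and minus the solution elsewhere, the rows of `e` give
      -- exactly `0` and the other rows have modulus at most `s`.
      let w₀ : κ → ℂ := fun l => if h : l = l₀ then 1 else -sol (Yv z) ⟨l, h⟩
      have hGw : ∀ r, (G *ᵥ w₀) r = z (r, l₀) - ζ (Yv z) r := by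
        intro r
        simp only [Matrix.mulVec, dotProduct, hG, Matrix.of_apply]
        rw [Fintype.sum_eq_add_sum_subtype_ne _ l₀, sub_eq_add_neg]
        congr 1
        · simp [w₀]
        · simp only [ζ]
          rw [← Finset.sum_neg_distrib]
          refine Finset.sum_congr rfl fun l _ => ?_
          rw [hextY z _ (by simp [hmemS, l.2])]
          simp [w₀, l.2]
      have hrow : ∀ r, ‖(G *ᵥ w₀) r‖ ^ 2 ≤ s ^ 2 := by
        intro r
        refine pow_le_pow_left₀ (norm_nonneg _) ?_ 2
        rw [hGw]
        by_cases hr : ∃ a, e a = r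
        · obtain ⟨a, rfl⟩ := hr
          have h1 : (A (Yv z) *ᵥ sol (Yv z)) a = ext (Yv z) (e a, l₀) := by
            simp only [sol]
            rw [Matrix.mulVec_mulVec, Matrix.mul_nonsing_inv _ (Ne.isUnit hzE.1), Matrix.one_mulVec]
          have h2 : ζ (Yv z) (e a) = z (e a, l₀) := by
            rw [← hextY z (e a, l₀) (by simp [hmemS]), ← h1]
            rfl
          rw [h2, sub_self, norm_zero]
          exact hs0.le
        · push Not at hr
          exact hzB ⟨(r, l₀), (hmemS _ _).2 ⟨hr, rfl⟩⟩
      have hle : normSq (G *ᵥ w₀) ≤ x := by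
        calc ∑ r, ‖(G *ᵥ w₀) r‖ ^ 2 ≤ ∑ _r : ρ, s ^ 2 := Finset.sum_le_sum fun r _ => hrow r
          _ = m * (x / (m + 1)) := by simp [hs2, m]
          _ ≤ x := by
              rw [mul_div_assoc', div_le_iff₀ (by positivity)]
              nlinarith
      -- The coordinate `1` at `l₀` makes `w₀` at least a unit long, so normalizing can only reduce
      -- the leakage.
      have hw1 : 1 ≤ normSq w₀ := by
        refine le_trans ?_ (Finset.single_le_sum (f := fun l => ‖w₀ l‖ ^ 2)
          (fun _ _ => by positivity) (Finset.mem_univ l₀))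
        simp [w₀]
      set t : ℂ := (((√(normSq w₀))⁻¹ : ℝ) : ℂ) with ht
      have ht2 : ‖t‖ ^ 2 = (normSq w₀)⁻¹ := by
        rw [ht, Complex.norm_real, Real.norm_eq_abs, sq_abs, inv_pow,
          Real.sq_sqrt (by linarith)]
      refine ⟨t • w₀, ?_, ?_⟩
      · rw [normSq_smul, ht2, inv_mul_cancel₀ (by positivity)]
      · rw [Matrix.mulVec_smul, normSq_smul, ht2]
        have := normSq_nonneg (G *ᵥ w₀)
        exact (mul_le_of_le_one_left this (inv_le_one_of_one_le₀ hw1)).trans hle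

end UserProbability

variable {K : ℕ} {L M S : Fin K → ℕ}

/-! ### The metric as the leakage of the stacked matrix. -/

section CrossLinks

lemma crossMatrix_mulVec (H : Channel K L M) (U : SignalBasis K M S) (i : Fin K) (j : ℕ)
    (w : Fin (L i) → ℂ) (r : CrossRow S i) :
    (crossMatrix H U i j *ᵥ w) r = received H U i j r.1 w r.2 := by
  rw [received, Matrix.mulVec_mulVec]
  rfl

/-- The metric of a user is the squared norm of its stacked cross-link matrix applied to its weight
vector. -/
lemma metric_eq_normSq (W : WeightRule K L S) (H : Channel K L M) (U : SignalBasis K M S)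
    (i : Fin K) (j : ℕ) :
    metric W H U i j = normSq (crossMatrix H U i j *ᵥ W i (crossMatrix H U i j)) := by
  simp only [metric, normSq, crossMatrix_mulVec, Fintype.sum_sigma, weight]
  rw [← Finset.sum_subtype (Finset.univ.erase i) (by simp)
    (fun k => ∑ s : Fin (S k), ‖received H U i j k (W i (crossMatrix H U i j)) s‖ ^ 2)]

lemma card_crossRow (S : Fin K → ℕ) (i : Fin K) :
    Fintype.card (CrossRow S i) = otherStreams S i := by
  rw [Fintype.card_sigma, otherStreams, ← Finset.sum_subtype (Finset.univ.erase i) (by simp)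
    (fun k => Fintype.card (Fin (S k)))]
  simp

lemma normSq_received_le_metric (W : WeightRule K L S) (H : Channel K L M)
    (U : SignalBasis K M S) {i k : Fin K} (hk : k ≠ i) (j : ℕ) :
    normSq (received H U i j k (weight W H U i j)) ≤ metric W H U i j :=
  Finset.single_le_sum (f := fun k => normSq (received H U i j k (weight W H U i j)))
    (fun _ _ => normSq_nonneg _) (by simp [hk])

lemma crossMatrix_apply (H : Channel K L M) (U : SignalBasis K M S) (i : Fin K) (j : ℕ)
    (r : CrossRow S i) (l : Fin (L i)) :
    crossMatrix H U i j r l = ∑ m, star (U r.1 m r.2) * H i j r.1 m l := rfl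

lemma received_apply (H : Channel K L M) (U : SignalBasis K M S) (i : Fin K) (j : ℕ) (k : Fin K)
    (w : Fin (L i) → ℂ) (s : Fin (S k)) :
    received H U i j k w s = ∑ m, star (U k m s) * ∑ l, H i j k m l * w l := rfl

end CrossLinks

/-! ### Measurability of weights, metrics and selection. -/

section Measurability

variable {α : Type*} [MeasurableSpace α] {h : α → Channel K L M} {u : α → SignalBasis K M S}

lemma measurable_channel_apply (hh : Measurable h) (i j k m l) :
    Measurable fun a => h a i j k m l :=
  measurable_pi_iff.1 (measurable_pi_iff.1 (measurable_pi_iff.1 (measurable_pi_iff.1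
    (measurable_pi_iff.1 hh i) j) k) m) l

lemma measurable_basis_apply (hu : Measurable u) (k m s) : Measurable fun a => u a k m s :=
  measurable_pi_iff.1 (measurable_pi_iff.1 (measurable_pi_iff.1 hu k) m) s

lemma measurable_star_basis_apply (hu : Measurable u) (k m s) :
    Measurable fun a => star (u a k m s) :=
  continuous_star.measurable.comp (measurable_basis_apply hu k m s)

lemma measurable_matrix_iff {m n : Type*} {A : α → Matrix m n ℂ} :
    Measurable A ↔ ∀ i j, Measurable fun a => A a i j :=
  measurable_pi_iff.trans (forall_congr' fun _ => measurable_pi_iff)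

lemma measurable_crossMatrix (hh : Measurable h) (hu : Measurable u) (i : Fin K) (j : ℕ) :
    Measurable fun a => crossMatrix (h a) (u a) i j := by
  refine measurable_matrix_iff.2 fun r l => ?_
  simp only [crossMatrix_apply]
  exact Finset.measurable_sum _ fun m _ =>
    (measurable_star_basis_apply hu _ _ _).mul (measurable_channel_apply hh _ _ _ _ _)

lemma measurable_received (hh : Measurable h) (hu : Measurable u) (i : Fin K) (j : ℕ) (k : Fin K)
    {w : α → Fin (L i) → ℂ} (hw : Measurable w) :
    Measurable fun a => received (h a) (u a) i j k (w a) := by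
  refine measurable_pi_iff.2 fun s => ?_
  simp only [received_apply]
  exact Finset.measurable_sum _ fun m _ => (measurable_star_basis_apply hu _ _ _).mul
    (Finset.measurable_sum _ fun l _ => (measurable_channel_apply hh _ _ _ _ _).mul
      (measurable_pi_iff.1 hw l))

variable {W : WeightRule K L S} {sel : SelectionRule K S}

lemma measurable_normSq_mulVec_rule (hW : ∀ i, Measurable (W i)) (i : Fin K)
    {A : α → Matrix (CrossRow S i) (Fin (L i)) ℂ} (hA : Measurable A) :
    Measurable fun a => normSq (A a *ᵥ W i (A a)) := by
  refine measurable_normSq.comp (measurable_pi_iff.2 fun r => ?_)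
  exact Finset.measurable_sum Finset.univ fun l _ => Measurable.mul (f := fun a => A a r l)
    (measurable_matrix_iff.1 hA r l) (measurable_pi_iff.1 ((hW i).comp hA) l)

lemma measurable_weight (hW : ∀ i, Measurable (W i)) (hh : Measurable h) (hu : Measurable u)
    (i : Fin K) (j : ℕ) : Measurable fun a => weight W (h a) (u a) i j :=
  (hW i).comp (measurable_crossMatrix hh hu i j)

lemma measurable_metric (hW : ∀ i, Measurable (W i)) (hh : Measurable h) (hu : Measurable u)
    (i : Fin K) (j : ℕ) : Measurable fun a => metric W (h a) (u a) i j := by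
  simp only [metric_eq_normSq]
  exact measurable_normSq_mulVec_rule hW i (measurable_crossMatrix hh hu i j)

lemma measurable_selected (hW : ∀ i, Measurable (W i)) (hsel : ∀ i n, Measurable (sel i n))
    (hh : Measurable h) (hu : Measurable u) (n : Fin K → ℕ) (i : Fin K) (s : Fin (S i)) :
    Measurable fun a => selected W sel n (h a) (u a) i s :=
  measurable_pi_iff.1 ((hsel i (n i)).comp
    (measurable_pi_iff.2 fun j : Fin (n i) => measurable_metric hW hh hu i j)) s

/-- Selected users have random indices; countability of the index set keeps quantities evaluated at
them measurable. -/
lemma measurable_countable_index {β : Type*} [MeasurableSpace β] {f : ℕ → α → β}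
    (hf : ∀ j, Measurable (f j)) {k : α → ℕ} (hk : Measurable k) :
    Measurable fun a => f (k a) a := by
  have : Measurable fun p : ℕ × α => f p.1 p.2 := measurable_from_prod_countable_right hf
  exact this.comp (hk.prodMk measurable_id)

end Measurability

/-! ### The law of the channel, with the basis frozen. -/

section IIDChannel

/-- The law of the channels: all entries are i.i.d. complex Gaussian. -/
structure IsIIDChannel (v : ℝ≥0) (μ : Measure (Channel K L M)) : Prop where
  law : ∀ x : Σ i : Fin K, ℕ × Σ k : Fin K, Fin (M k) × Fin (L i),
    HasLaw (fun H : Channel K L M => H x.1 x.2.1 x.2.2.1 x.2.2.2.1 x.2.2.2.2)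
      (complexGaussian v) μ
  indep : iIndepFun (fun (x : Σ i : Fin K, ℕ × Σ k : Fin K, Fin (M k) × Fin (L i))
    (H : Channel K L M) => H x.1 x.2.1 x.2.2.1 x.2.2.2.1 x.2.2.2.2) μ

lemma IsChannelModel.aemeasurable_channel {Ω : Type*} [MeasurableSpace Ω] {P : Measure Ω}
    {v : ℝ≥0} {H : Ω → Channel K L M} {U : Ω → SignalBasis K M S} (hHU : IsChannelModel P v H U) :
    AEMeasurable H P := by
  refine aemeasurable_pi_iff.2 fun i => aemeasurable_pi_iff.2 fun j => aemeasurable_pi_iff.2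
    fun k => aemeasurable_pi_iff.2 fun a => aemeasurable_pi_iff.2 fun l => ?_
  exact (hHU.law i j k a l).aemeasurable

/-- Passing to the law of `H` replaces channels that are only almost everywhere measurable by
genuinely measurable coordinates. -/
lemma IsChannelModel.isIIDChannel {Ω : Type*} [MeasurableSpace Ω] {P : Measure Ω}
    [IsProbabilityMeasure P] {v : ℝ≥0} {H : Ω → Channel K L M} {U : Ω → SignalBasis K M S}
    (hHU : IsChannelModel P v H U) : IsIIDChannel v (P.map H) := by
  have hm := hHU.aemeasurable_channel
  have := Measure.isProbabilityMeasure_map hm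
  have hlaw : ∀ x : Σ i : Fin K, ℕ × Σ k : Fin K, Fin (M k) × Fin (L i),
      HasLaw (fun H : Channel K L M => H x.1 x.2.1 x.2.2.1 x.2.2.2.1 x.2.2.2.2)
        (complexGaussian v) (P.map H) := fun x => by
    have hx : Measurable fun H : Channel K L M => H x.1 x.2.1 x.2.2.1 x.2.2.2.1 x.2.2.2.2 :=
      measurable_channel_apply measurable_id _ _ _ _ _
    refine ⟨hx.aemeasurable, ?_⟩
    rw [AEMeasurable.map_map_of_aemeasurable hx.aemeasurable hm]
    exact (hHU.law _ _ _ _ _).map_eq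
  refine ⟨hlaw, ?_⟩
  have hmeas : Measurable fun (H : Channel K L M)
      (x : Σ i : Fin K, ℕ × Σ k : Fin K, Fin (M k) × Fin (L i)) =>
      H x.1 x.2.1 x.2.2.1 x.2.2.2.1 x.2.2.2.2 :=
    measurable_pi_iff.2 fun x => measurable_channel_apply measurable_id _ _ _ _ _
  rw [iIndepFun_iff_hasLaw_Pi_infinitePi hlaw hmeas.aemeasurable]
  refine ⟨hmeas.aemeasurable, ?_⟩
  rw [AEMeasurable.map_map_of_aemeasurable hmeas.aemeasurable hm]
  exact (hHU.indep.hasLaw_infinitePi (fun x => hHU.law _ _ _ _ _)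
    (hmeas.comp_aemeasurable hm)).map_eq

/-- A bound on the probability of an event that holds for all constant bases holds for random
ones. -/
lemma IsChannelModel.measure_le {Ω : Type*} [MeasurableSpace Ω] {P : Measure Ω}
    [IsProbabilityMeasure P] {v : ℝ≥0} {H : Ω → Channel K L M} {U : Ω → SignalBasis K M S}
    (hHU : IsChannelModel P v H U) {B : Channel K L M → SignalBasis K M S → Prop}
    (hB : MeasurableSet {p : SignalBasis K M S × Channel K L M | B p.2 p.1}) {ε : ℝ≥0∞}
    (hε : ∀ u : SignalBasis K M S, (∀ k, (u k)ᴴ * u k = 1) → P.map H {h | B h u} ≤ ε) :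
    P {ω | B (H ω) (U ω)} ≤ ε := by
  have hm := hHU.aemeasurable_channel
  refine measure_prodMk_mem_le (X := U) (Y := H) hHU.measurable_basis.aemeasurable hm
    hHU.indep_basis.symm hB ?_
  have horth : MeasurableSet {u : SignalBasis K M S | ∀ k, (u k)ᴴ * u k = 1} := by
    have : {u : SignalBasis K M S | ∀ k, (u k)ᴴ * u k = 1} =
        ⋂ k, ⋂ a, ⋂ b, {u | ∑ m, star (u k m a) * u k m b = (1 : Matrix _ _ ℂ) a b} := by
      ext u
      simp only [Set.mem_ofPred_eq, Set.mem_iInter, ← Matrix.ext_iff]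
      rfl
    rw [this]
    refine MeasurableSet.iInter fun k => MeasurableSet.iInter fun a => MeasurableSet.iInter
      fun b => measurableSet_eq_fun ?_ measurable_const
    exact Finset.measurable_sum _ fun m _ => (measurable_star_basis_apply measurable_id k m a).mul
      (measurable_basis_apply measurable_id k m b)
  have hae : ∀ᵐ u : SignalBasis K M S ∂(P.map U), ∀ k, (u k)ᴴ * u k = 1 :=
    (ae_map_iff hHU.measurable_basis.aemeasurable horth).2 hHU.orthonormal
  filter_upwards [hae] with u hu
  refine le_trans (le_of_eq ?_) (hε u hu)
  exact (Measure.map_apply_of_aemeasurable hm (hB.preimage measurable_prodMk_left)).symm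

variable {v : ℝ≥0} {μ : Measure (Channel K L M)}

lemma IsIIDChannel.hasLaw_pi (hμ : IsIIDChannel v μ) {κ : Type*} [Fintype κ]
    {g : κ → Σ i : Fin K, ℕ × Σ k : Fin K, Fin (M k) × Fin (L i)} (hg : Function.Injective g) :
    HasLaw (fun (H : Channel K L M) x =>
        H (g x).1 (g x).2.1 (g x).2.2.1 (g x).2.2.2.1 (g x).2.2.2.2)
      (Measure.pi fun _ => complexGaussian v) μ :=
  (hμ.indep.precomp hg).hasLaw_pi fun x => hμ.law (g x)

/-- The stacked cross-link matrix of a user has i.i.d. complex Gaussian entries. -/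
lemma IsIIDChannel.hasLaw_crossMatrix (hμ : IsIIDChannel v μ) {u : SignalBasis K M S}
    (hu : ∀ k, (u k)ᴴ * u k = 1) (i : Fin K) (j : ℕ) :
    HasLaw (fun (H : Channel K L M) (x : CrossRow S i × Fin (L i)) => crossMatrix H u i j x.1 x.2)
      (Measure.pi fun _ => complexGaussian v) μ := by
  classical
  let g : (Σ k : {k : Fin K // k ≠ i}, Fin (M k)) × Fin (L i) →
      Σ i : Fin K, ℕ × Σ k : Fin K, Fin (M k) × Fin (L i) :=
    fun x => ⟨i, j, x.1.1, x.1.2, x.2⟩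
  have hg : Function.Injective g := by
    rintro ⟨⟨⟨k, hk⟩, m⟩, l⟩ ⟨⟨⟨k', hk'⟩, m'⟩, l'⟩ h
    simp only [g, Sigma.mk.injEq, heq_eq_eq, true_and, Prod.mk.injEq] at h
    obtain ⟨rfl, h⟩ := h
    simp only [heq_eq_eq, Prod.mk.injEq] at h
    obtain ⟨rfl, rfl⟩ := h
    rfl
  -- Stacking the blocks `U kᴴ H` acts on the vectorized channel as a block-diagonal matrix tensored
  -- with the identity, whose rows are orthonormal.
  let B : Matrix (CrossRow S i × Fin (L i))
      ((Σ k : {k : Fin K // k ≠ i}, Fin (M k)) × Fin (L i)) ℂ :=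
    Matrix.kroneckerMap (· * ·)
      (Matrix.blockDiagonal' fun k : {k : Fin K // k ≠ i} => (u k)ᴴ) (1 : Matrix (Fin (L i)) _ ℂ)
  have hB : B * Bᴴ = 1 := by
    simp only [B]
    rw [Matrix.conjTranspose_kronecker, ← Matrix.mul_kronecker_mul,
      Matrix.blockDiagonal'_conjTranspose, ← Matrix.blockDiagonal'_mul]
    simp only [Matrix.conjTranspose_conjTranspose, hu, Matrix.conjTranspose_one, Matrix.mul_one]
    rw [show (fun k : {k : Fin K // k ≠ i} => (1 : Matrix (Fin (S k)) (Fin (S k)) ℂ)) = 1 from rfl,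
      Matrix.blockDiagonal'_one, Matrix.one_kronecker_one]
  have h1 := hμ.hasLaw_pi hg
  have h2 : HasLaw (fun z => B *ᵥ z) (Measure.pi fun _ => complexGaussian v)
      (Measure.pi fun _ => complexGaussian v) :=
    ⟨Measurable.aemeasurable (by fun_prop), map_mulVec_pi_complexGaussian v B hB⟩
  have h3 := h2.fun_comp h1
  convert h3 using 3 with H x
  obtain ⟨⟨k, s⟩, l⟩ := x
  simp only [crossMatrix_apply, Matrix.mulVec, dotProduct, B, Fintype.sum_prod_type,
    Fintype.sum_sigma, Matrix.kroneckerMap_apply, Matrix.one_apply, g]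
  rw [Finset.sum_eq_single k]
  · simp [Matrix.blockDiagonal'_apply]
  · intro k' _ hk'
    simp [Matrix.blockDiagonal'_apply, hk'.symm]
  · simp

end IIDChannel

/-! ### Independent blocks and minima of independent variables. -/

section IndependentBlocks

variable {Ω ι κ E : Type*} [MeasurableSpace Ω] [MeasurableSpace E] {P : Measure Ω}
  [IsProbabilityMeasure P]

/-- Disjoint blocks of an independent family are independent. -/
lemma iIndepFun_blocks {X : (Σ _ : ι, κ) → Ω → E} (hX : ∀ p, Measurable (X p))
    (h : iIndepFun X P) : iIndepFun (fun (j : ι) ω (x : κ) => X ⟨j, x⟩ ω) P := by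
  have : ∀ p, IsProbabilityMeasure (P.map (X p)) :=
    fun p => Measure.isProbabilityMeasure_map (hX p).aemeasurable
  rw [iIndepFun_iff_map_fun_eq_infinitePi_map (by fun_prop)]
  have hblock : ∀ j, P.map (fun ω (x : κ) => X ⟨j, x⟩ ω) =
      Measure.infinitePi fun x => P.map (X ⟨j, x⟩) := fun j =>
    (iIndepFun_iff_map_fun_eq_infinitePi_map (by fun_prop)).1
      (h.precomp (g := fun x : κ => (⟨j, x⟩ : Σ _ : ι, κ)) (fun a b hab => by simpa using hab))
  simp only [hblock]
  -- Currying turns a product measure over pairs into a product of product measures.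
  have := Measure.infinitePi_map_piCurry (fun (j : ι) (x : κ) => P.map (X ⟨j, x⟩))
  rw [← this]
  have h2 := (iIndepFun_iff_map_fun_eq_infinitePi_map hX).1 h
  rw [← h2, Measure.map_map (MeasurableEquiv.measurable _) (by fun_prop)]
  rfl

/-- Among `m` independent variables, each below `x` with probability at least `p`, all exceed `x`
with probability at most `exp (-p m)`. -/
lemma measure_forall_gt_le {η : ℕ → Ω → ℝ} (hη : ∀ j, Measurable (η j)) (hind : iIndepFun η P)
    {x p : ℝ} (hp : ∀ j, ENNReal.ofReal p ≤ P {ω | η j ω ≤ x}) (T : Finset ℕ) :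
    P {ω | ∀ j ∈ T, x < η j ω} ≤ ENNReal.ofReal (Real.exp (-(p * T.card))) := by
  have h1 : {ω | ∀ j ∈ T, x < η j ω} = ⋂ j ∈ T, η j ⁻¹' Set.Ioi x := by
    ext ω; simp
  rw [h1, hind.measure_inter_preimage_eq_mul T (sets := fun _ => Set.Ioi x)
    (fun _ _ => measurableSet_Ioi)]
  have h2 : ∀ j, P (η j ⁻¹' Set.Ioi x) ≤ ENNReal.ofReal (Real.exp (-p)) := by
    intro j
    have h3 : η j ⁻¹' Set.Ioi x = {ω | η j ω ≤ x}ᶜ := by ext ω; simp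
    rw [h3, prob_compl_eq_one_sub (measurableSet_le (hη j) measurable_const)]
    calc 1 - P {ω | η j ω ≤ x} ≤ 1 - ENNReal.ofReal p := tsub_le_tsub_left (hp j) 1
      _ ≤ ENNReal.ofReal (Real.exp (-p)) := by
        rw [tsub_le_iff_right, ← ENNReal.ofReal_one]
        refine le_trans (ENNReal.ofReal_le_ofReal ?_) ENNReal.ofReal_add_le
        linarith [Real.add_one_le_exp (-p)]
  calc ∏ j ∈ T, P (η j ⁻¹' Set.Ioi x) ≤ ∏ _j ∈ T, ENNReal.ofReal (Real.exp (-p)) :=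
        Finset.prod_le_prod' fun j _ => h2 j
    _ = _ := by
        rw [Finset.prod_const, ← ENNReal.ofReal_pow (Real.exp_nonneg _), ← Real.exp_nat_mul]
        congr 2; ring

end IndependentBlocks

/-! ### Selecting the smallest metrics. -/

section Selection

variable {sel : SelectionRule K S}

lemma IsSmallestSelection.injective (hsel : IsSmallestSelection sel) {i : Fin K} {n : ℕ}
    (hn : S i ≤ n) (η : Fin n → ℝ) : Function.Injective (sel i n η) := by
  obtain ⟨e, he, -⟩ := hsel.smallest i n hn η
  intro a b hab
  rw [he, he] at hab
  exact e.injective (Fin.ext hab)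

/-- If there are at least `S i` users with metric at most `x`, then only such users are selected. -/
lemma IsSmallestSelection.metric_le (hsel : IsSmallestSelection sel) {i : Fin K} {n : ℕ}
    (hn : S i ≤ n) (η : ℕ → ℝ) {x : ℝ} {g : Fin (S i) → Fin n} (hg : Function.Injective g)
    (hgx : ∀ a, η (g a) ≤ x) (a : Fin (S i)) : η (sel i n (fun j => η j) a) ≤ x := by
  obtain ⟨e, he, hmin⟩ := hsel.smallest i n hn (fun j => η j)
  rw [he]
  by_contra! hlt
  -- If a selected metric exceeded `x`, every one of the `S i` users `g b` would be selected and
  -- differ from `e a`, leaving only `S i - 1` places.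
  have hsub : ∀ b, g b ∈ Finset.univ.map e \ {e a} := by
    intro b
    simp only [Finset.mem_sdiff, Finset.mem_singleton, Finset.mem_map, Finset.mem_univ, true_and]
    constructor
    · by_contra hb
      have := hmin a (g b) (fun ⟨c, hc⟩ => hb ⟨c, hc⟩)
      linarith [hgx b]
    · intro hb
      have := hgx b
      rw [hb] at this
      linarith
  have hcard : Fintype.card (Fin (S i)) ≤ (Finset.univ.map e \ {e a}).card :=
    Finset.card_le_card_of_injOn (s := Finset.univ) g (fun b _ => hsub b) hg.injOn
  rw [Finset.card_sdiff_of_subset (by simp), Finset.card_map, Finset.card_univ,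
    Fintype.card_fin, Finset.card_singleton] at hcard
  have := a.pos
  omega

variable {Ω : Type*} [MeasurableSpace Ω] {P : Measure Ω} [IsProbabilityMeasure P]

/-- With many users of independent metrics, all selected metrics are small. -/
lemma IsSmallestSelection.measure_exists_gt_le (hsel : IsSmallestSelection sel) {i : Fin K} {n : ℕ}
    (hn : S i ≤ n) {η : ℕ → Ω → ℝ} (hη : ∀ j, Measurable (η j)) (hind : iIndepFun η P)
    {x p : ℝ} (hp : ∀ j, ENNReal.ofReal p ≤ P {ω | η j ω ≤ x}) :
    P {ω | ∃ a, x < η (sel i n (fun j => η j ω) a) ω} ≤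
      S i * ENNReal.ofReal (Real.exp (-(p * (n / S i : ℕ)))) := by
  set m := n / S i with hm
  have hmn : S i * m ≤ n := Nat.mul_div_le n (S i)
  -- Disjoint blocks of `m` users, one for each place. One user below `x` in every block yields `S
  -- i` distinct such users.
  let T : Fin (S i) → Finset ℕ := fun a => Finset.Ico (a * m) ((a + 1) * m)
  have hT : ∀ a, (T a).card = m := fun a => by
    simp only [T, Nat.card_Ico]
    rw [add_mul, one_mul, Nat.add_sub_cancel_left]
  have hsub : {ω | ∃ a, x < η (sel i n (fun j => η j ω) a) ω} ⊆
      ⋃ a, {ω | ∀ j ∈ T a, x < η j ω} := by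
    rintro ω ⟨a, ha⟩
    by_contra hcon
    simp only [Set.mem_iUnion, Set.mem_ofPred_eq, not_exists, not_forall, not_lt] at hcon
    choose g hgT hgx using hcon
    have hgn : ∀ b, g b < n := fun b => by
      have h1 := (Finset.mem_Ico.1 (hgT b)).2
      have h2 : ((b : ℕ) + 1) * m ≤ S i * m := Nat.mul_le_mul_right _ b.2
      omega
    have hginj : Function.Injective fun b => (⟨g b, hgn b⟩ : Fin n) := by
      intro b c hbc
      simp only [Fin.mk.injEq] at hbc
      have hb := Finset.mem_Ico.1 (hgT b)
      have hc := Finset.mem_Ico.1 (hgT c)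
      rw [hbc] at hb
      have h1 : (b : ℕ) * m < (c + 1) * m := hb.1.trans_lt hc.2
      have h2 : (c : ℕ) * m < (b + 1) * m := hc.1.trans_lt hb.2
      have h3 := Nat.lt_of_mul_lt_mul_right h1
      have h4 := Nat.lt_of_mul_lt_mul_right h2
      exact Fin.ext (by omega)
    exact absurd (hsel.metric_le hn (fun j => η j ω) hginj hgx a) (not_le.2 ha)
  calc _ ≤ P (⋃ a, {ω | ∀ j ∈ T a, x < η j ω}) := measure_mono hsub
    _ ≤ ∑ a, P {ω | ∀ j ∈ T a, x < η j ω} := measure_iUnion_fintype_le _ _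
    _ ≤ ∑ _a : Fin (S i), ENNReal.ofReal (Real.exp (-(p * m))) := by
        refine Finset.sum_le_sum fun a _ => ?_
        have := measure_forall_gt_le hη hind hp (T a)
        rwa [hT] at this
    _ = _ := by simp

end Selection

/-! ### Metrics of the users of a cell. -/

section Users

variable {v : ℝ≥0} {μ : Measure (Channel K L M)}
  {W : WeightRule K L S}

/-- A user with a Gaussian cross-link matrix has leakage at most `x` with probability at least
`c * x ^ m`. -/
def LeakageBound (v : ℝ≥0) (W : WeightRule K L S) (i : Fin K) (m : ℕ) (c : ℝ) : Prop :=
  ∀ x : ℝ, 0 < x → x ≤ 1 → ENNReal.ofReal (c * x ^ m) ≤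
    (Measure.pi fun _ : CrossRow S i × Fin (L i) => complexGaussian v)
      {z | normSq (Matrix.of (fun r l => z (r, l)) *ᵥ W i (Matrix.of fun r l => z (r, l))) ≤ x}

lemma IsIIDChannel.measure_metric_le_ge (hμ : IsIIDChannel v μ) (hW : ∀ i, Measurable (W i))
    {u : SignalBasis K M S} (hu : ∀ k, (u k)ᴴ * u k = 1) {i : Fin K} {m : ℕ} {c : ℝ}
    (hc : LeakageBound v W i m c) (j : ℕ) {x : ℝ} (hx : 0 < x) (hx1 : x ≤ 1) :
    ENNReal.ofReal (c * x ^ m) ≤ μ {H | metric W H u i j ≤ x} := by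
  refine (hc x hx hx1).trans (le_of_eq ?_)
  have hmeas : Measurable fun z : CrossRow S i × Fin (L i) → ℂ =>
      normSq (Matrix.of (fun r l => z (r, l)) *ᵥ W i (Matrix.of fun r l => z (r, l))) :=
    measurable_normSq_mulVec_rule hW i
      (measurable_matrix_iff.2 fun r l => measurable_pi_apply (r, l))
  rw [← (hμ.hasLaw_crossMatrix hu i j).measure_eq (measurableSet_le hmeas measurable_const)]
  simp only [metric_eq_normSq]
  rfl

variable [IsProbabilityMeasure μ]

/-- The metrics of the users of a cell are independent. -/
lemma IsIIDChannel.iIndepFun_metric (hμ : IsIIDChannel v μ) (hW : ∀ i, Measurable (W i))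
    (u : SignalBasis K M S) (i : Fin K) :
    iIndepFun (fun j (H : Channel K L M) => metric W H u i j) μ := by
  let κ := Σ k : Fin K, Fin (M k) × Fin (L i)
  have hg : Function.Injective fun p : (Σ _ : ℕ, κ) =>
      (⟨i, p.1, p.2⟩ : Σ i : Fin K, ℕ × Σ k : Fin K, Fin (M k) × Fin (L i)) := by
    rintro ⟨j, x⟩ ⟨j', x'⟩ h
    simp only [Sigma.mk.injEq, heq_eq_eq, true_and, Prod.mk.injEq] at h
    obtain ⟨rfl, rfl⟩ := h
    rfl
  have hblocks := iIndepFun_blocks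
    (fun p : (Σ _ : ℕ, κ) =>
      measurable_channel_apply measurable_id i p.1 p.2.1 p.2.2.1 p.2.2.2)
    (hμ.indep.precomp hg)
  let G : (κ → ℂ) → Matrix (CrossRow S i) (Fin (L i)) ℂ := fun b => Matrix.of fun r l =>
    ∑ m, star (u r.1 m r.2) * b ⟨r.1, m, l⟩
  have hG : Measurable G := by
    refine measurable_matrix_iff.2 fun r l => ?_
    simp only [G, Matrix.of_apply]
    exact Finset.measurable_sum _ fun m _ => (measurable_pi_apply _).const_mul _
  have := hblocks.comp (fun _ b => normSq (G b *ᵥ W i (G b)))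
    (fun _ => measurable_normSq_mulVec_rule hW i hG)
  simp only [metric_eq_normSq]
  exact this

lemma IsIIDChannel.measure_selected_metric_gt_le (hμ : IsIIDChannel v μ)
    (hW : ∀ i, Measurable (W i)) {sel : SelectionRule K S} (hsel : IsSmallestSelection sel)
    {u : SignalBasis K M S} (hu : ∀ k, (u k)ᴴ * u k = 1) {i : Fin K} {m : ℕ} {c : ℝ}
    (hc : LeakageBound v W i m c) {n : Fin K → ℕ} (hn : S i ≤ n i) {x : ℝ} (hx : 0 < x)
    (hx1 : x ≤ 1) :
    μ {H | ∃ a, x < metric W H u i (selected W sel n H u i a)} ≤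
      S i * ENNReal.ofReal (Real.exp (-(c * x ^ m * (n i / S i : ℕ)))) :=
  hsel.measure_exists_gt_le hn (fun j => measurable_metric hW measurable_id measurable_const i j)
    (hμ.iIndepFun_metric hW u i) (fun j => hμ.measure_metric_le_ge hW hu hc j hx hx1)

end Users

/-! ### Independence of the direct links from selection and weights. -/

section DirectLinks

/-- The channels to the base stations of the other cells. -/
def crossPart (H : Channel K L M) : Channel K L M :=
  fun i j k => if k = i then 0 else H i j k

/-- The channels of the users to their own base stations. -/
def directPart (H : Channel K L M) : Channel K L M :=
  fun i j k => if k = i then H i j k else 0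

/-- Zeroing the direct channels changes nothing, as only base stations `k ≠ i` enter the stack.
Hence weights and selections are functions of `crossPart H`. -/
lemma crossMatrix_crossPart (H : Channel K L M) (U : SignalBasis K M S) (i : Fin K) (j : ℕ) :
    crossMatrix (crossPart H) U i j = crossMatrix H U i j := by
  ext r l
  simp [crossMatrix_apply, crossPart, r.1.2]

lemma weight_crossPart (W : WeightRule K L S) (H : Channel K L M) (U : SignalBasis K M S)
    (i : Fin K) (j : ℕ) : weight W (crossPart H) U i j = weight W H U i j := by
  rw [weight, crossMatrix_crossPart, weight]

lemma selected_crossPart (W : WeightRule K L S) (sel : SelectionRule K S) (n : Fin K → ℕ)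
    (H : Channel K L M) (U : SignalBasis K M S) (i : Fin K) (a : Fin (S i)) :
    selected W sel n (crossPart H) U i a = selected W sel n H U i a := by
  simp only [selected, metric_eq_normSq, crossMatrix_crossPart]

lemma received_directPart (H : Channel K L M) (U : SignalBasis K M S) (i : Fin K) (j : ℕ)
    (w : Fin (L i) → ℂ) : received (directPart H) U i j i w = received H U i j i w := by
  simp [received, directPart]

lemma measurable_channel {α : Type*} [MeasurableSpace α] {h : α → Channel K L M}
    (hh : ∀ i j k m l, Measurable fun a => h a i j k m l) : Measurable h :=
  measurable_pi_iff.2 fun i => measurable_pi_iff.2 fun j => measurable_pi_iff.2 fun k =>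
    measurable_pi_iff.2 fun m => measurable_pi_iff.2 fun l => hh i j k m l

lemma measurable_crossPart : Measurable (crossPart : Channel K L M → Channel K L M) := by
  refine measurable_channel fun i j k m l => ?_
  by_cases h : k = i
  · simp only [crossPart, h, if_true]; exact measurable_const
  · simp only [crossPart, h, if_false]
    exact measurable_channel_apply measurable_id i j k m l

lemma measurable_directPart : Measurable (directPart : Channel K L M → Channel K L M) := by
  refine measurable_channel fun i j k m l => ?_
  by_cases h : k = i
  · simp only [directPart, h, if_true]
    exact measurable_channel_apply measurable_id i j _ m l
  · simp only [directPart, h, if_false]; exact measurable_const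

variable {v : ℝ≥0} {μ : Measure (Channel K L M)}

lemma IsIIDChannel.indepFun_crossPart_directPart (hμ : IsIIDChannel v μ) :
    IndepFun crossPart directPart μ := by
  let coord := fun (x : Σ i : Fin K, ℕ × Σ k : Fin K, Fin (M k) × Fin (L i))
    (H : Channel K L M) => H x.1 x.2.1 x.2.2.1 x.2.2.2.1 x.2.2.2.2
  let m : (Σ i : Fin K, ℕ × Σ k : Fin K, Fin (M k) × Fin (L i)) →
      MeasurableSpace (Channel K L M) := fun x => MeasurableSpace.comap (coord x) inferInstance
  have hle : ∀ x, m x ≤ MeasurableSpace.pi := fun x =>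
    (measurable_channel_apply measurable_id x.1 x.2.1 x.2.2.1 x.2.2.2.1 x.2.2.2.2).comap_le
  have hind : iIndep m μ := (iIndepFun_iff_iIndep _ _ _).1 hμ.indep
  -- The entries with receiver `k ≠ i` generate `crossPart`, the complementary ones `directPart`;
  -- disjoint families of independent entries generate independent sigma-algebras.
  let A : Set (Σ i : Fin K, ℕ × Σ k : Fin K, Fin (M k) × Fin (L i)) := {x | x.2.2.1 ≠ x.1}
  have hdisj : Disjoint A Aᶜ := disjoint_compl_right
  have key := indep_iSup_of_disjoint hle hind hdisj
  have hcoord : ∀ (B : Set (Σ i : Fin K, ℕ × Σ k : Fin K, Fin (M k) × Fin (L i))), ∀ x ∈ B,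
      Measurable[⨆ x ∈ B, m x] (coord x) := fun B x hx =>
    (comap_measurable (coord x)).mono (le_iSup₂_of_le x hx le_rfl) le_rfl
  rw [IndepFun_iff_Indep]
  refine indep_of_indep_of_le_right (indep_of_indep_of_le_left key ?_) ?_
  · refine Measurable.comap_le (m₁ := ⨆ x ∈ A, m x) ?_
    refine @measurable_channel _ _ _ _ (⨆ x ∈ A, m x) _ fun i j k a l => ?_
    by_cases h : k = i
    · simp only [crossPart, h, if_true]; exact measurable_const
    · simp only [crossPart, h, if_false]
      exact hcoord A ⟨i, j, k, a, l⟩ h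
  · refine Measurable.comap_le (m₁ := ⨆ x ∈ Aᶜ, m x) ?_
    refine @measurable_channel _ _ _ _ (⨆ x ∈ Aᶜ, m x) _ fun i j k a l => ?_
    by_cases h : k = i
    · simp only [directPart, h, if_true]
      subst h
      exact hcoord Aᶜ ⟨k, j, k, a, l⟩ (by simp [A])
    · simp only [directPart, h, if_false]; exact measurable_const

/-- For fixed distinct users and fixed unit weight vectors, the matrix of received directions at the
own base station has i.i.d. complex Gaussian entries. -/
lemma IsIIDChannel.hasLaw_direct (hμ : IsIIDChannel v μ) {u : SignalBasis K M S}
    (hu : ∀ k, (u k)ᴴ * u k = 1) (i : Fin K) {s : Fin (S i) → ℕ} (hs : Function.Injective s)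
    {w : Fin (S i) → Fin (L i) → ℂ} (hw : ∀ a, normSq (w a) = 1) :
    HasLaw (fun (H : Channel K L M) (x : Fin (S i) × Fin (S i)) =>
        received H u i (s x.2) i (w x.2) x.1)
      (Measure.pi fun _ => complexGaussian v) μ := by
  let g : Fin (M i) × (Fin (S i) × Fin (L i)) →
      Σ i : Fin K, ℕ × Σ k : Fin K, Fin (M k) × Fin (L i) :=
    fun x => ⟨i, s x.2.1, i, x.1, x.2.2⟩
  have hg : Function.Injective g := by
    rintro ⟨m, a, l⟩ ⟨m', a', l'⟩ h
    simp only [g, Sigma.mk.injEq, heq_eq_eq, true_and, Prod.mk.injEq] at h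
    obtain ⟨h1, rfl, rfl⟩ := h
    rw [hs h1]
  -- Row `a` of `D` places the weight vector of user `a` in its own block; unit weights make the
  -- rows orthonormal.
  let D : Matrix (Fin (S i)) (Fin (S i) × Fin (L i)) ℂ :=
    Matrix.of fun a x => if a = x.1 then w a x.2 else 0
  have hD : D * Dᴴ = 1 := by
    ext a b
    simp only [D, Matrix.mul_apply, Matrix.of_apply, Matrix.conjTranspose_apply,
      Fintype.sum_prod_type, Matrix.one_apply]
    by_cases hab : a = b
    · subst hab
      have := congrArg (fun x : ℝ => (x : ℂ)) (hw a)
      simp only [normSq, Complex.ofReal_sum, Complex.ofReal_one] at this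
      rw [if_pos rfl, ← this, Finset.sum_eq_single a]
      · refine Finset.sum_congr rfl fun l _ => ?_
        simp [Complex.mul_conj, Complex.normSq_eq_norm_sq]
      · intro c _ hc
        simp [hc.symm]
      · simp
    · rw [if_neg hab]
      refine Finset.sum_eq_zero fun c _ => Finset.sum_eq_zero fun l _ => ?_
      by_cases hac : a = c
      · subst hac
        simp [Ne.symm hab]
      · simp [hac]
  let B : Matrix (Fin (S i) × Fin (S i)) (Fin (M i) × (Fin (S i) × Fin (L i))) ℂ :=
    Matrix.kroneckerMap (· * ·) (u i)ᴴ D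
  have hB : B * Bᴴ = 1 := by
    simp only [B]
    rw [Matrix.conjTranspose_kronecker, ← Matrix.mul_kronecker_mul, hD,
      Matrix.conjTranspose_conjTranspose, hu, Matrix.one_kronecker_one]
  have h2 : HasLaw (fun z => B *ᵥ z) (Measure.pi fun _ => complexGaussian v)
      (Measure.pi fun _ => complexGaussian v) :=
    ⟨Measurable.aemeasurable (by fun_prop), map_mulVec_pi_complexGaussian v B hB⟩
  have h3 := h2.fun_comp (hμ.hasLaw_pi hg)
  convert h3 using 3 with H x
  obtain ⟨r, a⟩ := x
  simp only [received_apply, Matrix.mulVec, dotProduct, B, Fintype.sum_prod_type,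
    Matrix.kroneckerMap_apply, D, Matrix.of_apply, g, Finset.mul_sum]
  refine Finset.sum_congr rfl fun m _ => ?_
  rw [Finset.sum_eq_single a]
  · refine Finset.sum_congr rfl fun l _ => ?_
    simp
    ring
  · intro b _ hb
    simp [hb.symm]
  · simp

variable {W : WeightRule K L S} {sel : SelectionRule K S} [IsProbabilityMeasure μ]

/-- Selection and weights do not bias the direct links: the matrix of received directions of the
selected users at their own base station has i.i.d. complex Gaussian entries. -/
lemma IsIIDChannel.measure_selectedReceived_mem_le (hμ : IsIIDChannel v μ)
    (hW : ∀ i, Measurable (W i)) (hunit : ∀ i G, normSq (W i G) = 1)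
    (hsel : IsSmallestSelection sel) {u : SignalBasis K M S} (hu : ∀ k, (u k)ᴴ * u k = 1)
    {n : Fin K → ℕ} {i : Fin K} (hn : S i ≤ n i) {T : Set (Fin (S i) × Fin (S i) → ℂ)}
    (hT : MeasurableSet T) :
    μ {H | (fun x : Fin (S i) × Fin (S i) => selectedReceived W sel n H u i i x.2 x.1) ∈ T} ≤
      (Measure.pi fun _ => complexGaussian v) T := by
  -- The first argument decides selection and weights, the second supplies the direct channels, so
  -- the first can be frozen.
  let Φ : Channel K L M × Channel K L M → Fin (S i) × Fin (S i) → ℂ := fun p x =>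
    received p.2 u i (selected W sel n p.1 u i x.2) i
      (weight W p.1 u i (selected W sel n p.1 u i x.2)) x.1
  have hΦ : Measurable Φ := by
    refine measurable_pi_iff.2 fun x => ?_
    have hk : Measurable fun p : Channel K L M × Channel K L M => selected W sel n p.1 u i x.2 :=
      measurable_selected (h := Prod.fst) (u := fun _ => u) hW hsel.measurable
        measurable_fst measurable_const n i x.2
    have hw : ∀ j, Measurable fun p : Channel K L M × Channel K L M => weight W p.1 u i j :=
      fun j => measurable_weight (h := Prod.fst) (u := fun _ => u) hW measurable_fst
        measurable_const i j
    have hf : ∀ j, Measurable fun p : Channel K L M × Channel K L M =>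
        received p.2 u i j i (weight W p.1 u i j) :=
      fun j => measurable_received (h := Prod.snd) (u := fun _ => u) measurable_snd
        measurable_const i j i (hw j)
    have hfx : ∀ j, Measurable fun p : Channel K L M × Channel K L M =>
        received p.2 u i j i (weight W p.1 u i j) x.1 :=
      fun j => (measurable_pi_apply x.1).comp (hf j)
    exact measurable_countable_index hfx hk
  have hle := measure_prodMk_mem_le (X := crossPart) (Y := directPart)
    (measurable_crossPart (L := L) (M := M)).aemeasurable measurable_directPart.aemeasurable
    hμ.indepFun_crossPart_directPart (hT.preimage hΦ)
    (ε := (Measure.pi fun _ => complexGaussian v) T) (ae_of_all _ fun y => ?_)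
  · refine le_trans (le_of_eq ?_) hle
    congr 1
    ext H
    simp only [Set.mem_ofPred_eq, Set.mem_preimage, Φ, selected_crossPart, weight_crossPart,
      received_directPart]
    rfl
  · have hlaw := hμ.hasLaw_direct hu i
      (s := fun a => selected W sel n y u i a) (hsel.injective hn _)
      (w := fun a => weight W y u i (selected W sel n y u i a)) (fun a => hunit _ _)
    refine le_of_eq ?_
    simp only [Set.mem_preimage, Φ, received_directPart]
    exact hlaw.measure_eq (p := fun z => z ∈ T) hT

end DirectLinks

/-! ### Tightness of the zero-forcing equalizer. -/

section Tightness

/-- The matrix is invertible, and its zero-forcing equalizer has columns of squared norm at most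
`C`. -/
def HasBoundedEqualizer {κ : Type*} [Fintype κ] [DecidableEq κ] (C : ℝ) (A : Matrix κ κ ℂ) : Prop :=
  A.det ≠ 0 ∧ ∀ a, normSq (fun r => (A⁻¹)ᴴ r a) ≤ C

variable {κ : Type*} [Fintype κ] [DecidableEq κ]

lemma measurableSet_hasBoundedEqualizer {α : Type*} [MeasurableSpace α] {A : α → Matrix κ κ ℂ}
    (hA : ∀ i j, Measurable fun a => A a i j) (C : ℝ) :
    MeasurableSet {a | HasBoundedEqualizer C (A a)} := by
  have : {a | HasBoundedEqualizer C (A a)} = {a | (A a).det = 0}ᶜ ∩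
      ⋂ b, {a | normSq (fun r => ((A a)⁻¹)ᴴ r b) ≤ C} := by
    ext a; simp [HasBoundedEqualizer]
  rw [this]
  refine ((measurableSet_singleton (0 : ℂ)).preimage (measurable_det hA)).compl.inter
    (MeasurableSet.iInter fun b => measurableSet_le (measurable_normSq.comp
      (measurable_pi_iff.2 fun r => ?_)) measurable_const)
  exact continuous_star.measurable.comp (measurable_inv_apply hA b r)

/-- The bad events decrease in `C`, and their intersection forces a singular matrix, which is a null
event. Allowing every `C ≥ C₀` lets all cells share one constant. -/
lemma exists_measure_not_hasBoundedEqualizer_le {v : ℝ≥0} (hv : v ≠ 0) {ε : ℝ≥0∞} (hε : 0 < ε) :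
    ∃ C₀ : ℝ, ∀ C ≥ C₀, (Measure.pi fun _ : κ × κ => complexGaussian v)
      {z | ¬ HasBoundedEqualizer C (Matrix.of fun a b => z (a, b))} ≤ ε := by
  set P : Measure (κ × κ → ℂ) := Measure.pi fun _ : κ × κ => complexGaussian v
  let Z : ℕ → Set (κ × κ → ℂ) :=
    fun C => {z | ¬ HasBoundedEqualizer C (Matrix.of fun a b => z (a, b))}
  have hmono : ∀ {C C' : ℝ}, C ≤ C' → {z : κ × κ → ℂ |
      ¬ HasBoundedEqualizer C' (Matrix.of fun a b => z (a, b))} ⊆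
      {z | ¬ HasBoundedEqualizer C (Matrix.of fun a b => z (a, b))} :=
    fun hC z hz h => hz ⟨h.1, fun a => (h.2 a).trans hC⟩
  have hlim := tendsto_measure_iInter_atTop (μ := P) (s := Z)
    (fun C => (measurableSet_hasBoundedEqualizer
      (fun a b => measurable_pi_apply (a, b)) C).compl.nullMeasurableSet)
    (fun C C' h => hmono (by exact_mod_cast h)) ⟨0, measure_ne_top _ _⟩
  have hnull : P (⋂ C, Z C) = 0 := by
    have := nullSingletonClass_complexGaussian hv
    refine measure_mono_null (fun z hz => ?_) (ae_det_ne_zero (κ := κ) (complexGaussian v))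
    simp only [Set.mem_compl_iff, Set.mem_ofPred_eq, not_not]
    by_contra hdet
    obtain ⟨C, hC⟩ := exists_nat_ge
      (∑ a, normSq fun r => ((Matrix.of fun a b => z (a, b) : Matrix κ κ ℂ)⁻¹)ᴴ r a)
    exact Set.mem_iInter.1 hz C ⟨hdet, fun a => (Finset.single_le_sum
      (f := fun a => normSq fun r => ((Matrix.of fun a b => z (a, b) : Matrix κ κ ℂ)⁻¹)ᴴ r a)
      (fun _ _ => normSq_nonneg _) (Finset.mem_univ a)).trans hC⟩
  rw [hnull] at hlim
  obtain ⟨C, hC⟩ := (hlim.eventually_le_const hε).exists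
  exact ⟨C, fun C' h => (measure_mono (hmono h)).trans hC⟩

end Tightness

/-! ### Deterministic rate bound. -/

section RateBound

lemma norm_dotProduct_sq_le {ι : Type*} [Fintype ι] (x y : ι → ℂ) :
    ‖star x ⬝ᵥ y‖ ^ 2 ≤ normSq x * normSq y := by
  have h1 : ‖star x ⬝ᵥ y‖ ≤ ∑ a, ‖x a‖ * ‖y a‖ := by
    refine (norm_sum_le _ _).trans (le_of_eq ?_)
    exact Finset.sum_congr rfl fun a _ => by simp
  exact (pow_le_pow_left₀ (norm_nonneg _) h1 2).trans
    (Finset.sum_mul_sq_le_sq_mul_sq Finset.univ (fun a => ‖x a‖) (fun a => ‖y a‖))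

/-- Positivity keeps the denominator of the SINR away from `0`, where division by convention would
give rate `0`. -/
lemma normSq_col_equalizer_pos {κ : Type*} [Fintype κ] [DecidableEq κ] {A : Matrix κ κ ℂ}
    (hA : A.det ≠ 0) (a : κ) : 0 < normSq (fun r => (A⁻¹)ᴴ r a) := by
  refine lt_of_le_of_ne (normSq_nonneg _) fun h0 => ?_
  have hcol : ∀ r, (A⁻¹)ᴴ r a = 0 := by
    intro r
    have := (Finset.sum_eq_zero_iff_of_nonneg (fun _ _ => by positivity)).1 h0.symm r
      (Finset.mem_univ r)
    simpa using this
  have hdet := Matrix.det_eq_zero_of_column_eq_zero a hcol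
  rw [Matrix.det_conjTranspose, star_eq_zero, Matrix.det_nonsing_inv] at hdet
  rw [Ring.inverse_eq_inv', inv_eq_zero] at hdet
  exact hA hdet

variable {W : WeightRule K L S} {sel : SelectionRule K S} {n : Fin K → ℕ} {snr C : ℝ}
  {H : Channel K L M} {U : SignalBasis K M S}

lemma interference_le (hsnr : 0 < snr)
    (hmetric : ∀ i a, metric W H U i (selected W sel n H U i a) ≤ 1 / snr)
    {i : Fin K} {a : Fin (S i)} (hC : normSq (equalizerCol W sel n H U i a) ≤ C) :
    interference W sel n snr H U i a ≤ C * ∑ k, (S k : ℝ) := by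
  have hC0 : 0 ≤ C := (normSq_nonneg _).trans hC
  have hterm : ∀ k ∈ Finset.univ.erase i, ∀ b : Fin (S k),
      ‖star (equalizerCol W sel n H U i a) ⬝ᵥ selectedReceived W sel n H U i k b‖ ^ 2 * snr ≤ C := by
    intro k hk b
    have h1 := norm_dotProduct_sq_le (equalizerCol W sel n H U i a)
      (selectedReceived W sel n H U i k b)
    have h2 : normSq (selectedReceived W sel n H U i k b) ≤ 1 / snr :=
      (normSq_received_le_metric W H U (Finset.ne_of_mem_erase hk).symm _).trans (hmetric k b)
    have h3 := h1.trans (mul_le_mul hC h2 (normSq_nonneg _) hC0)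
    calc _ ≤ C * (1 / snr) * snr := mul_le_mul_of_nonneg_right h3 hsnr.le
      _ = C := by field_simp
  calc interference W sel n snr H U i a
      ≤ ∑ k ∈ Finset.univ.erase i, ∑ _b : Fin (S k), C :=
        Finset.sum_le_sum fun k hk => Finset.sum_le_sum fun b _ => hterm k hk b
    _ ≤ ∑ k, ∑ _b : Fin (S k), C :=
        Finset.sum_le_sum_of_subset_of_nonneg (Finset.erase_subset _ _)
          fun _ _ _ => Finset.sum_nonneg fun _ _ => hC0
    _ = C * ∑ k, (S k : ℝ) := by
        rw [Finset.mul_sum]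
        exact Finset.sum_congr rfl fun k _ => by simp [mul_comm]

lemma rate_ge (hsnr : 0 < snr)
    (hmetric : ∀ i a, metric W H U i (selected W sel n H U i a) ≤ 1 / snr) (i : Fin K)
    (heq : HasBoundedEqualizer C (Matrix.of fun r a => selectedReceived W sel n H U i i a r))
    (a : Fin (S i)) :
    Real.log snr - Real.log (C * (1 + ∑ k, (S k : ℝ))) ≤ rate W sel n snr H U i a := by
  have hpos : 0 < normSq (equalizerCol W sel n H U i a) := normSq_col_equalizer_pos heq.1 a
  have hC : normSq (equalizerCol W sel n H U i a) ≤ C := heq.2 a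
  have hI := interference_le hsnr hmetric hC
  have hI0 : 0 ≤ interference W sel n snr H U i a :=
    Finset.sum_nonneg fun k _ => Finset.sum_nonneg fun b _ => by positivity
  have hS : (0 : ℝ) ≤ ∑ k, (S k : ℝ) := Finset.sum_nonneg fun _ _ => by positivity
  have hC0 : 0 < C := hpos.trans_le hC
  have hD : 0 < normSq (equalizerCol W sel n H U i a) + interference W sel n snr H U i a := by
    linarith
  rw [← Real.log_div hsnr.ne' (by positivity)]
  refine Real.log_le_log (by positivity) ?_
  calc snr / (C * (1 + ∑ k, (S k : ℝ)))
      ≤ snr / (normSq (equalizerCol W sel n H U i a) + interference W sel n snr H U i a) :=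
        div_le_div_of_nonneg_left hsnr.le hD (by linarith)
    _ ≤ _ := by linarith

lemma sumRate_ge (hsnr : 0 < snr)
    (hmetric : ∀ i a, metric W H U i (selected W sel n H U i a) ≤ 1 / snr)
    (heq : ∀ i, HasBoundedEqualizer C
      (Matrix.of fun r a => selectedReceived W sel n H U i i a r)) :
    (∑ i, (S i : ℝ)) * (Real.log snr - Real.log (C * (1 + ∑ k, (S k : ℝ)))) ≤
      sumRate W sel n snr H U := by
  rw [Finset.sum_mul]
  refine Finset.sum_le_sum fun i _ => ?_
  calc _ = ∑ _a : Fin (S i), (Real.log snr - Real.log (C * (1 + ∑ k, (S k : ℝ)))) := by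
        simp [mul_sub]
    _ ≤ _ := Finset.sum_le_sum fun a _ => rate_ge hsnr hmetric i (heq i) a

end RateBound

/-! ### Consequences of the user scaling. -/

section UserScaling

lemma UserScaling.mono {N : Fin K → ℝ → ℕ} {e e' : Fin K → ℝ} (h : UserScaling N e')
    (he : ∀ i, e i ≤ e' i) : UserScaling N e := by
  intro i
  refine Asymptotics.IsBigO.trans_isLittleO (Asymptotics.IsBigO.of_bound 1 ?_) (h i)
  filter_upwards [eventually_ge_atTop 1] with x hx
  rw [one_mul, Real.norm_of_nonneg (by positivity), Real.norm_of_nonneg (by positivity)]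
  exact Real.rpow_le_rpow_of_exponent_le hx (he i)

lemma UserScaling.eventually_le {N : Fin K → ℝ → ℕ} {m : Fin K → ℕ}
    (h : UserScaling N fun i => (m i : ℝ)) (i : Fin K) (A : ℝ) :
    ∀ᶠ snr in atTop, A * snr ^ m i ≤ N i snr := by
  filter_upwards [(h i).def (c := (|A| + 1)⁻¹) (by positivity), eventually_ge_atTop 0] with x hx hx0
  rw [Real.rpow_natCast, Real.norm_of_nonneg (by positivity), Real.norm_of_nonneg (by positivity),
    ← div_eq_inv_mul, le_div_iff₀ (by positivity)] at hx
  have : 0 ≤ x ^ m i := by positivity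
  nlinarith [le_abs_self A]

/-- A quotient that is at least `1` loses at most a factor `2` when rounded down. -/
lemma half_div_le_natDiv {n s : ℕ} (hs : 1 ≤ s) (hn : s ≤ n) :
    (n : ℝ) / (2 * s) ≤ (n / s : ℕ) := by
  have h1 : n < (n / s + 1) * s := by
    have := Nat.lt_mul_div_succ n hs
    rwa [mul_comm] at this
  have h2 : 1 ≤ n / s := (Nat.one_le_div_iff hs).2 hn
  have h3 : n ≤ (n / s) * (2 * s) := by nlinarith
  rw [div_le_iff₀ (by positivity)]
  exact_mod_cast h3

end UserScaling

/-! ### High-probability bounds and degrees of freedom. -/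

section DegreesOfFreedom

variable {Ω : Type*} [MeasurableSpace Ω] {P : Measure Ω} [IsProbabilityMeasure P] {v : ℝ≥0}
  {H : Ω → Channel K L M} {U : Ω → SignalBasis K M S} {N : Fin K → ℝ → ℕ}
  {W : WeightRule K L S} {sel : SelectionRule K S}

/-- All selected users of a cell cause little interference, with high probability. -/
lemma eventually_measure_metric_gt_le (hS : ∀ i, 1 ≤ S i) (hHU : IsChannelModel P v H U)
    (hsel : IsSmallestSelection sel) (hW : ∀ i, Measurable (W i)) {m : Fin K → ℕ}
    (hN : UserScaling N fun i => (m i : ℝ)) (i : Fin K) {c : ℝ} (hc : 0 < c)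
    (hleak : LeakageBound v W i (m i) c) {ε : ℝ≥0∞} (hε : 0 < ε) :
    ∀ᶠ snr in atTop, P {ω | ∃ a, 1 / snr < metric W (H ω) (U ω) i
      (selected W sel (fun i => N i snr) (H ω) (U ω) i a)} ≤ ε := by
  -- With at least `A * snr ^ m i` users, the failure bound at threshold `1 / snr` no longer depends
  -- on `snr`; a suitable `A` brings it below `ε`.
  have hlim : Tendsto (fun A : ℝ => (S i : ℝ≥0∞) *
      ENNReal.ofReal (Real.exp (-(c * (A / (2 * S i)))))) atTop (𝓝 0) := by
    have h1 : Tendsto (fun A : ℝ => Real.exp (-(c * (A / (2 * S i))))) atTop (𝓝 0) := by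
      refine Real.tendsto_exp_neg_atTop_nhds_zero.comp ?_
      have : (0 : ℝ) < 2 * S i := by have := hS i; positivity
      exact (tendsto_id.atTop_div_const this).const_mul_atTop hc
    have h2 := ENNReal.Tendsto.const_mul (a := (S i : ℝ≥0∞)) (ENNReal.tendsto_ofReal h1)
      (Or.inr (ENNReal.natCast_ne_top _))
    simpa using h2
  obtain ⟨A, hA⟩ := (hlim.eventually_le_const hε).exists
  have := Measure.isProbabilityMeasure_map hHU.aemeasurable_channel
  filter_upwards [hN.eventually_le i A, hN.eventually_le i (S i), eventually_ge_atTop 1]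
    with snr h1 h2 hsnr
  have hsnr0 : 0 < snr := by linarith
  have hpow : (1 : ℝ) ≤ snr ^ m i := one_le_pow₀ hsnr
  have hn : S i ≤ N i snr := by
    have : (S i : ℝ) ≤ N i snr := by
      refine le_trans ?_ h2
      exact le_mul_of_one_le_right (by positivity) hpow
    exact_mod_cast this
  refine hHU.measure_le (B := fun h u => ∃ a, 1 / snr < metric W h u i
      (selected W sel (fun i => N i snr) h u i a)) ?_ fun u hu => ?_
  · have : {p : SignalBasis K M S × Channel K L M | ∃ a, 1 / snr < metric W p.2 p.1 i
        (selected W sel (fun i => N i snr) p.2 p.1 i a)} = ⋃ a, {p | 1 / snr < metric W p.2 p.1 i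
        (selected W sel (fun i => N i snr) p.2 p.1 i a)} := by
      ext p; simp
    rw [this]
    refine MeasurableSet.iUnion fun a => measurableSet_lt measurable_const ?_
    exact measurable_countable_index
      (fun j => measurable_metric (h := Prod.snd) (u := Prod.fst) hW measurable_snd
        measurable_fst i j)
      (measurable_selected (h := Prod.snd) (u := Prod.fst) hW hsel.measurable measurable_snd
        measurable_fst _ i a)
  · refine (hHU.isIIDChannel.measure_selected_metric_gt_le hW hsel hu hleak hn
      (x := 1 / snr) (by positivity) (by rw [div_le_one hsnr0]; exact hsnr)).trans
      (le_trans ?_ hA)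
    refine mul_le_mul_right (ENNReal.ofReal_le_ofReal (Real.exp_le_exp.2 (neg_le_neg ?_))) _
    rw [mul_assoc]
    refine mul_le_mul_of_nonneg_left ?_ hc.le
    have hs : (0 : ℝ) < S i := by have := hS i; positivity
    calc A / (2 * S i) = (1 / snr) ^ m i * ((A * snr ^ m i) / (2 * S i)) := by
          have : (1 / snr) ^ m i * snr ^ m i = 1 := by
            rw [← mul_pow, one_div_mul_cancel hsnr0.ne', one_pow]
          rw [← mul_div_assoc, mul_left_comm, this, mul_one]
      _ ≤ (1 / snr) ^ m i * (N i snr / (2 * S i)) := by gcongr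
      _ ≤ _ := mul_le_mul_of_nonneg_left (half_div_le_natDiv (hS i) hn) (by positivity)

/-- The zero-forcing equalizers are bounded, with high probability. -/
lemma measure_not_hasBoundedEqualizer_le (hHU : IsChannelModel P v H U)
    (hsel : IsSmallestSelection sel) (hW : ∀ i, Measurable (W i))
    (hunit : ∀ i G, normSq (W i G) = 1) {n : Fin K → ℕ} {i : Fin K} (hn : S i ≤ n i) (C : ℝ) :
    P {ω | ¬ HasBoundedEqualizer C
      (Matrix.of fun r a => selectedReceived W sel n (H ω) (U ω) i i a r)} ≤
    (Measure.pi fun _ : Fin (S i) × Fin (S i) => complexGaussian v)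
      {z | ¬ HasBoundedEqualizer C (Matrix.of fun a b => z (a, b))} := by
  have := Measure.isProbabilityMeasure_map hHU.aemeasurable_channel
  refine hHU.measure_le (B := fun h u => ¬ HasBoundedEqualizer C
      (Matrix.of fun r a => selectedReceived W sel n h u i i a r)) ?_ fun u hu => ?_
  · refine MeasurableSet.compl (measurableSet_hasBoundedEqualizer (fun r a => ?_) C)
    have hf : ∀ j, Measurable fun p : SignalBasis K M S × Channel K L M =>
        received p.2 p.1 i j i (weight W p.2 p.1 i j) r := fun j =>
      (measurable_pi_apply r).comp (measurable_received (h := Prod.snd) (u := Prod.fst)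
        measurable_snd measurable_fst i j i (measurable_weight (h := Prod.snd) (u := Prod.fst)
          hW measurable_snd measurable_fst i j))
    exact measurable_countable_index hf (measurable_selected (h := Prod.snd) (u := Prod.fst)
      hW hsel.measurable measurable_snd measurable_fst n i a)
  · exact hHU.isIIDChannel.measure_selectedReceived_mem_le hW hunit hsel hu hn
      (T := {z | ¬ HasBoundedEqualizer C (Matrix.of fun a b => z (a, b))})
      (measurableSet_hasBoundedEqualizer (fun a b => measurable_pi_apply (a, b)) C).compl

/-- Full degrees of freedom from a polynomial lower bound on the probability of small leakage. -/
theorem achievesDoF_of_leakageBound (hS : ∀ i, 1 ≤ S i) (hHU : IsChannelModel P v H U)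
    (hsel : IsSmallestSelection sel) (hW : ∀ i, Measurable (W i))
    (hunit : ∀ i G, normSq (W i G) = 1) {m : Fin K → ℕ}
    (hleak : ∀ i, ∃ c, 0 < c ∧ LeakageBound v W i (m i) c)
    (hN : UserScaling N fun i => (m i : ℝ)) :
    AchievesDoF P H U N W sel (∑ i, (S i : ℝ)) := by
  intro δ hδ
  set d : ℝ := ∑ i, (S i : ℝ) with hd
  have hd0 : 0 ≤ d := Finset.sum_nonneg fun _ _ => by positivity
  set good : ℝ → Set Ω := fun snr =>
    {ω | d - δ ≤ sumRate W sel (fun i => N i snr) snr (H ω) (U ω) / Real.log snr}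
  suffices hbad : Tendsto (fun snr => P (good snr)ᶜ) atTop (𝓝 0) by
    have h1 : Tendsto (fun snr => 1 - P (good snr)ᶜ) atTop (𝓝 1) := by
      simpa using ENNReal.Tendsto.sub (tendsto_const_nhds (x := (1 : ℝ≥0∞))) hbad
        (Or.inl ENNReal.one_ne_top)
    refine tendsto_of_tendsto_of_tendsto_of_le_of_le h1 tendsto_const_nhds (fun snr => ?_)
      (fun snr => prob_le_one)
    -- Subadditivity alone bounds the good event from below, so its measurability is not needed.
    rw [tsub_le_iff_right, ← measure_univ (μ := P), ← Set.union_compl_self (good snr)]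
    exact measure_union_le _ _
  rw [ENNReal.tendsto_nhds_zero]
  intro ε hε
  -- There are two bad events per cell; the `+ 1` keeps the denominator nonzero when `K = 0`.
  set ε' : ℝ≥0∞ := ε / (2 * K + 1)
  have hε'0 : 0 < ε' := ENNReal.div_pos hε.ne' (by finiteness)
  choose c hc hcl using hleak
  choose C₀ hC₀ using fun i => exists_measure_not_hasBoundedEqualizer_le (κ := Fin (S i))
    hHU.variance_ne_zero hε'0
  obtain ⟨C, hC⟩ : ∃ C, ∀ i, C₀ i ≤ C :=
    ⟨∑ i, |C₀ i|, fun i => (le_abs_self _).trans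
      (Finset.single_le_sum (f := fun i => |C₀ i|) (fun _ _ => abs_nonneg _) (Finset.mem_univ i))⟩
  have hmet := eventually_all.2 fun i =>
    eventually_measure_metric_gt_le hS hHU hsel hW hN i (hc i) (hcl i) hε'0
  have hnum := eventually_all.2 fun i => hN.eventually_le i (S i)
  -- The last condition makes the constant loss `d * log (C * (1 + d))` at most `δ * log snr`.
  filter_upwards [hmet, hnum, eventually_gt_atTop 1,
    Real.tendsto_log_atTop.eventually_ge_atTop (d * Real.log (C * (1 + d)) / δ)]
    with snr h1 h2 hsnr hlog
  have hsnr0 : 0 < snr := by linarith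
  have hn : ∀ i, S i ≤ N i snr := fun i => by
    have : (S i : ℝ) ≤ N i snr := (le_mul_of_one_le_right (by positivity)
      (one_le_pow₀ hsnr.le)).trans (h2 i)
    exact_mod_cast this
  let bad₁ : Fin K → Set Ω := fun i => {ω | ∃ a, 1 / snr < metric W (H ω) (U ω) i
      (selected W sel (fun i => N i snr) (H ω) (U ω) i a)}
  let bad₂ : Fin K → Set Ω := fun i => {ω | ¬ HasBoundedEqualizer C
      (Matrix.of fun r a => selectedReceived W sel (fun i => N i snr) (H ω) (U ω) i i a r)}
  have hsub : (good snr)ᶜ ⊆ (⋃ i, bad₁ i) ∪ ⋃ i, bad₂ i := by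
    intro ω hω
    by_contra hcon
    simp only [Set.mem_union, Set.mem_iUnion, not_or, not_exists, bad₁, bad₂, Set.mem_ofPred_eq,
      not_lt, not_not] at hcon
    apply hω
    have hrate := sumRate_ge hsnr0 hcon.1 hcon.2
    have hl0 : 0 < Real.log snr := Real.log_pos hsnr
    change d - δ ≤ _
    rw [le_div_iff₀ hl0]
    refine le_trans ?_ hrate
    rw [div_le_iff₀ hδ] at hlog
    rw [← hd]
    linarith
  have hb₂ : ∀ i, P (bad₂ i) ≤ ε' := fun i =>
    (measure_not_hasBoundedEqualizer_le hHU hsel hW hunit (hn i) C).trans (hC₀ i C (hC i))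
  calc P (good snr)ᶜ ≤ P (⋃ i, bad₁ i) + P (⋃ i, bad₂ i) :=
        (measure_mono hsub).trans (measure_union_le _ _)
    _ ≤ ∑ i, P (bad₁ i) + ∑ i, P (bad₂ i) :=
        add_le_add (measure_iUnion_fintype_le _ _) (measure_iUnion_fintype_le _ _)
    _ ≤ ∑ _i : Fin K, ε' + ∑ _i : Fin K, ε' :=
        add_le_add (Finset.sum_le_sum fun i _ => h1 i) (Finset.sum_le_sum fun i _ => hb₂ i)
    _ = 2 * K * ε' := by simp; ring
    _ ≤ (2 * K + 1) * ε' := by gcongr; exact le_self_add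
    _ ≤ ε := ENNReal.mul_div_le

end DegreesOfFreedom

/-! ### Leakage exponents of the two weight designs. -/

section Schemes

variable {v : ℝ≥0} {W : WeightRule K L S}

lemma IsAntennaSelection.normSq_eq_one (hW : IsAntennaSelection W) (i : Fin K)
    (G : Matrix (CrossRow S i) (Fin (L i)) ℂ) : normSq (W i G) = 1 := by
  obtain ⟨l, hl, -⟩ := hW.argmin i G
  rw [hl, normSq_single]

/-- The selected antenna leaks no more than antenna `0`, whose column alone already gives the
exponent. -/
lemma IsAntennaSelection.exists_leakageBound (hW : IsAntennaSelection W) (hL : ∀ i, 1 ≤ L i)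
    (hv : v ≠ 0) (i : Fin K) : ∃ c, 0 < c ∧ LeakageBound v W i (otherStreams S i) c := by
  obtain ⟨c, hc, h⟩ := measure_column_normSq_le_ge (ρ := CrossRow S i) hv (⟨0, hL i⟩ : Fin (L i))
  rw [card_crossRow] at h
  refine ⟨c, hc, fun x hx hx1 => (h x hx hx1).trans (measure_mono fun z hz => ?_)⟩
  obtain ⟨l, hl, hmin⟩ := hW.argmin i (Matrix.of fun r l => z (r, l))
  change normSq _ ≤ x
  rw [hl]
  exact (hmin _).trans hz

/-- The minimizer does at least as well as any unit vector of small leakage; `L i ≤ otherStreams S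
i` leaves enough rows for the exact cancellation. -/
lemma IsSVDBased.exists_leakageBound (hW : IsSVDBased W) (hL : ∀ i, 1 ≤ L i) (hv : v ≠ 0)
    (i : Fin K) (hi : L i ≤ otherStreams S i) :
    ∃ c, 0 < c ∧ LeakageBound v W i (otherStreams S i - (L i - 1)) c := by
  obtain ⟨c, hc, h⟩ := measure_exists_unit_normSq_le_ge (ρ := CrossRow S i) hv
    (⟨0, hL i⟩ : Fin (L i)) (by rw [card_crossRow, Fintype.card_fin]; exact hi)
  rw [card_crossRow, Fintype.card_fin] at h
  refine ⟨c, hc, fun x hx hx1 => (h x hx hx1).trans (measure_mono fun z hz => ?_)⟩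
  obtain ⟨w, hw, hle⟩ := hz
  exact (hW.argmin i _ w hw).trans hle

end Schemes

end OIA

theorem theorem3 {Ω : Type*} [MeasurableSpace Ω] (P : Measure Ω) [IsProbabilityMeasure P]
    (K : ℕ) (L M S : Fin K → ℕ) (hL : ∀ i, 1 ≤ L i) (hS : ∀ i, 1 ≤ S i ∧ S i ≤ M i)
    (v : ℝ≥0) (H : Ω → OIA.Channel K L M) (U : Ω → OIA.SignalBasis K M S)
    (hHU : OIA.IsChannelModel P v H U)
    (N : Fin K → ℝ → ℕ)
    (sel : OIA.SelectionRule K S) (hsel : OIA.IsSmallestSelection sel) :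
    -- antenna selection, with the exponents `S'_i K`, and already with `S'_i`
    (∀ W : OIA.WeightRule K L S, OIA.IsAntennaSelection W →
      (OIA.UserScaling N (fun i => (OIA.otherStreams S i : ℝ) * K) →
        OIA.AchievesDoF P H U N W sel (∑ i, (S i : ℝ))) ∧
      (OIA.UserScaling N (fun i => (OIA.otherStreams S i : ℝ)) →
        OIA.AchievesDoF P H U N W sel (∑ i, (S i : ℝ)))) ∧
    -- SVD-based, with the exponents `S'_i K - L_i + 1`, and already with `S'_i - L_i + 1`
    ((∀ i, L i < OIA.otherStreams S i + 1) →
      ∀ W : OIA.WeightRule K L S, OIA.IsSVDBased W →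
        (OIA.UserScaling N (fun i => (OIA.otherStreams S i : ℝ) * K - L i + 1) →
          OIA.AchievesDoF P H U N W sel (∑ i, (S i : ℝ))) ∧
        (OIA.UserScaling N (fun i => (OIA.otherStreams S i : ℝ) - L i + 1) →
          OIA.AchievesDoF P H U N W sel (∑ i, (S i : ℝ)))) := by
  have hS1 : ∀ i, 1 ≤ S i := fun i => (hS i).1
  have hv := hHU.variance_ne_zero
  -- An index `i : Fin K` exists only if `K ≥ 1`, so multiplying by `K` does not decrease the
  -- exponent.
  have hKle : ∀ i, (OIA.otherStreams S i : ℝ) ≤ OIA.otherStreams S i * K := fun i =>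
    le_mul_of_one_le_right (Nat.cast_nonneg _) (by exact_mod_cast i.pos)
  refine ⟨fun W hW => ?_, fun hLS W hW => ?_⟩
  · have key : OIA.UserScaling N (fun i => (OIA.otherStreams S i : ℝ)) →
        OIA.AchievesDoF P H U N W sel (∑ i, (S i : ℝ)) := fun hN =>
      OIA.achievesDoF_of_leakageBound hS1 hHU hsel hW.measurable hW.normSq_eq_one
        (fun i => hW.exists_leakageBound hL hv i) hN
    exact ⟨fun hN => key (hN.mono hKle), key⟩
  · have key : OIA.UserScaling N (fun i => (OIA.otherStreams S i : ℝ) - L i + 1) →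
        OIA.AchievesDoF P H U N W sel (∑ i, (S i : ℝ)) := fun hN => by
      refine OIA.achievesDoF_of_leakageBound hS1 hHU hsel hW.measurable hW.unit
        (fun i => hW.exists_leakageBound hL hv i (Nat.lt_succ_iff.1 (hLS i))) (hN.mono fun i => ?_)
      have h1 := hL i
      have h2 := hLS i
      -- Neither natural subtraction truncates, since `1 ≤ L i ≤ S'`; the exponent `S' - (L i - 1)`
      -- is therefore `S' - L i + 1`.
      rw [Nat.cast_sub (by omega), Nat.cast_sub h1]
      push_cast
      linarith
    exact ⟨fun hN => key (hN.mono fun i => by linarith [hKle i]), key⟩
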